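/- Let $\Delta^{\mathbb{RP}^2}_9$ be the abstract simplicial complex on the vertex set $\{0,1,\dots,8\}$ whose facets are the $16$ triangles $$036,\ 037,\ 046,\ 047,\ 136,\ 138,\ 147,\ 148,\ 156,\ 157,\ 237,\ 238,\ 246,\ 248,\ 256,\ 257.$$ A finite $d$-dimensional simplicial complex is *balanced* if its vertices can be colored with $d+1$ colors so that the two ends of every edge have different colors. A *triangulation* of a topological space $X$ is a finite simplicial complex whose geometric realization is homeomorphic to $X$. Write $f_i(\Delta)$ for the number of $i$-dimensional faces of $\Delta$, the empty set being the only face of dimension $-1$. **Lemma.** The complex $\Delta^{\mathbb{RP}^2}_9$ is $2$-dimensional, with $f$-vector $(f_{-1},f_0,f_1,f_2)=(1,9,24,16)$, it is balanced, and it triangulates the real projective plane $\mathbb{RP}^2$. It is vertex-minimal, and indeed minimal in every $f_i$, among the balanced triangulations of $\mathbb{RP}^2$: if $\Gamma$ is any balanced triangulation of $\mathbb{RP}^2$, then $f_i(\Gamma)\ge f_i(\Delta^{\mathbb{RP}^2}_9)$ for all $i$; in particular $\Gamma$ has at least $9$ vertices. -/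

import Mathlib

namespace BalancedRP2

/-- `s` is a face of `K`, the empty face included. Mathlib's simplicial complexes record
nonempty faces only, while here the empty set counts as a face of dimension `-1`. -/
def IsFace {V : Type*} (K : PreAbstractSimplicialComplex V) (s : Finset V) : Prop :=
  s = ∅ ∨ s ∈ K.faces

/-- The number `f_i(K)` of faces of dimension `i`, that is with `i + 1` elements. -/
noncomputable def faceNumber {V : Type*} (K : PreAbstractSimplicialComplex V) (i : ℤ) : ℕ :=
  {s : Finset V | IsFace K s ∧ (s.card : ℤ) = i + 1}.ncard

/-- `K` has dimension `d`: there is a face with `d + 1` vertices and no face has more. -/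
def HasDim {V : Type*} (K : PreAbstractSimplicialComplex V) (d : ℕ) : Prop :=
  (∃ s ∈ K.faces, s.card = d + 1) ∧ ∀ s ∈ K.faces, s.card ≤ d + 1

/-- `K`, of dimension `d`, is balanced if its vertices have a colouring with `d + 1` colours in
which the two ends of every edge get different colours. -/
def IsBalanced {V : Type*} [DecidableEq V] (K : PreAbstractSimplicialComplex V) : Prop :=
  ∃ d : ℕ, HasDim K d ∧
    ∃ κ : V → Fin (d + 1), ∀ i j : V, i ≠ j → ({i, j} : Finset V) ∈ K.faces → κ i ≠ κ j

/-- The underlying set of the geometric realization of `K`: the points of the standard simplex on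
`V` (in barycentric coordinates) that are supported on a face of `K`. -/
def realizationSet {V : Type*} [Fintype V] (K : PreAbstractSimplicialComplex V) : Set (V → ℝ) :=
  {x | x ∈ stdSimplex ℝ V ∧ ∃ s ∈ K.faces, ∀ v, v ∉ s → x v = 0}

/-- The geometric realization of a complex on a finite set, with the topology of `V → ℝ`. -/
abbrev Realization {V : Type*} [Fintype V] (K : PreAbstractSimplicialComplex V) : Type _ :=
  realizationSet K

/-- `K` triangulates `X` if its geometric realization is homeomorphic to `X`. -/
def Triangulates {V : Type*} [Fintype V] (K : PreAbstractSimplicialComplex V)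
    (X : Type*) [TopologicalSpace X] : Prop :=
  Nonempty (Realization K ≃ₜ X)

/-- The unit sphere of Euclidean `3`-space. -/
abbrev Sphere2 : Type := Metric.sphere (0 : EuclideanSpace ℝ (Fin 3)) 1

/-- The antipodal equivalence relation on the sphere. -/
def antipodalSetoid : Setoid Sphere2 where
  r x y := x = y ∨ x = -y
  iseqv :=
    { refl := fun _ => Or.inl rfl
      symm := by
        rintro x y (h | h)
        · exact Or.inl h.symm
        · exact Or.inr (by rw [h, neg_neg])
      trans := by
        rintro x y z (h | h) (h' | h')
        · exact Or.inl (h.trans h')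
        · exact Or.inr (h.trans h')
        · exact Or.inr (by rw [h, h'])
        · exact Or.inl (by rw [h, h', neg_neg]) }

/-- The real projective plane, with the quotient topology. -/
abbrev RealProjectivePlane : Type := Quotient antipodalSetoid

/-- The complex generated by a set of facets: its faces are the subsets of the facets. -/
def generatedBy {V : Type*} (facets : Finset (Finset V)) : PreAbstractSimplicialComplex V where
  faces := {s | s.Nonempty ∧ ∃ F ∈ facets, s ⊆ F}
  isRelLowerSet_faces := by
    rintro s ⟨hs, F, hF, hsF⟩
    exact ⟨hs, fun t hts ht => ⟨ht, F, hF, hts.trans hsF⟩⟩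

/-- The `16` triangles of the balanced `9`-vertex projective plane; the colour classes are
`{0, 1, 2}`, `{3, 4, 5}` and `{6, 7, 8}`. -/
def facetsRP2 : Finset (Finset (Fin 9)) :=
  {{0, 3, 6}, {0, 3, 7}, {0, 4, 6}, {0, 4, 7}, {1, 3, 6}, {1, 3, 8}, {1, 4, 7}, {1, 4, 8},
   {1, 5, 6}, {1, 5, 7}, {2, 3, 7}, {2, 3, 8}, {2, 4, 6}, {2, 4, 8}, {2, 5, 6}, {2, 5, 7}}

/-- The balanced `9`-vertex triangulation of the real projective plane. -/
def deltaRP2 : PreAbstractSimplicialComplex (Fin 9) := generatedBy facetsRP2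

end BalancedRP2

set_option linter.unusedSectionVars false

/-! The complex is the octahedron with every facet cut into four triangles by its edge midpoints,
modulo the antipodal map. Piecewise linear barycentric coordinates on the sphere realize this as a
homeomorphism (`triangulates_deltaRP2`); the other facts about the complex are finite checks.

For minimality, let `Γ` be a balanced triangulation of the projective plane. The inequalities for
all face numbers follow from three relations: `f₀ ≥ 9`, `2 f₁ = 3 f₂` and `f₀ - f₁ + f₂ ≤ 1`.
Together they give `f₁ ≥ 24` and `f₂ ≥ 16`.

The relation `2 f₁ = 3 f₂` says that every edge lies in exactly two triangles
(`exists_two_triangles`). Homology is replaced by continuous logarithms: a chart has no logarithm on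
a punctured neighbourhood of its centre, because a small circle has winding number one. Boundary
points and faces of dimension at least three would produce such a logarithm. Three triangles on an
edge would give incompatible mapping degrees (`no_three_pages`). Since removing finitely many points
does not disconnect the plane, there are no maximal vertices or edges, and any two triangles are
joined by a chain of triangles with consecutive common edges (`triangle_induction`).

The double covering by the sphere yields a cocycle mod 2 on the edges; it is not a coboundary, since
the covering has no section (`exists_cocycle`). With the connectedness just mentioned, rank counting
for the incidence matrices mod 2 gives the Euler inequality (`euler_le`).

The same cocycle gives `f₀ ≥ 9`. If some colour class had at most two vertices, every edge in the
other two colours would be coned to both of them, so `Γ` would be the suspension of a connected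
graph. On such a suspension every cocycle is a coboundary, a contradiction. Hence each of the three
colour classes has at least three vertices (`three_le_card_colorClass`). -/

namespace BalancedRP2

open Topology Set

/-! ### Topology of the projective plane: double covering, finite complements, charts. -/

/-- The quotient map from the sphere to the projective plane. -/
def proj : Sphere2 → RealProjectivePlane := Quotient.mk antipodalSetoid

theorem proj_eq_proj {x y : Sphere2} : proj x = proj y ↔ x = y ∨ x = -y :=
  Quotient.eq (r := antipodalSetoid)

theorem proj_neg (x : Sphere2) : proj (-x) = proj x := proj_eq_proj.2 (Or.inr rfl)

theorem continuous_proj : Continuous proj := continuous_quotient_mk'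

theorem surjective_proj : Function.Surjective proj := Quotient.mk_surjective

theorem isOpenMap_proj : IsOpenMap proj := by
  intro U hU
  have : IsOpen (proj ⁻¹' (proj '' U)) := by
    have h : proj ⁻¹' (proj '' U) = U ∪ (fun x => -x) ⁻¹' U := by
      ext x
      constructor
      · rintro ⟨y, hy, hxy⟩
        rcases proj_eq_proj.1 hxy with h | h
        · exact Or.inl (h ▸ hy)
        · right
          show -x ∈ U
          rw [← h]; exact hy
      · rintro (h | h)
        · exact ⟨x, h, rfl⟩
        · exact ⟨-x, h, proj_neg x⟩
    rw [h]
    exact hU.union (hU.preimage continuous_neg)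
  exact this

theorem sphere_ne_neg (x : Sphere2) : x ≠ -x := by
  intro h
  have h1 : (x : EuclideanSpace ℝ (Fin 3)) = -x := congrArg Subtype.val h
  have h2 : (x : EuclideanSpace ℝ (Fin 3)) = 0 := by
    have h2 : (2 : ℝ) • (x : EuclideanSpace ℝ (Fin 3)) = 0 := by
      rw [two_smul]; exact eq_neg_iff_add_eq_zero.1 h1
    simpa using h2
  have h3 : ‖(x : EuclideanSpace ℝ (Fin 3))‖ = 1 := by simp
  rw [h2] at h3
  simp at h3

/-- On the open hemisphere centred at a point no two points are antipodal, so the open map `proj` is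
injective there. -/
theorem isLocalHomeomorph_proj : IsLocalHomeomorph proj := by
  rw [isLocalHomeomorph_iff_isOpenEmbedding_restrict]
  intro x
  let U : Set Sphere2 := {y | 0 < inner ℝ (x : EuclideanSpace ℝ (Fin 3)) y}
  have hU : IsOpen U := isOpen_lt continuous_const (by fun_prop)
  have hx : x ∈ U := by
    have h3 : ‖(x : EuclideanSpace ℝ (Fin 3))‖ = 1 := by simp
    simp [U]
  refine ⟨U, hU.mem_nhds hx, .of_continuous_injective_isOpenMap ?_ ?_ ?_⟩
  · exact continuous_proj.comp continuous_subtype_val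
  · rintro ⟨y, hy⟩ ⟨z, hz⟩ h
    rcases proj_eq_proj.1 h with h | h
    · exact Subtype.ext h
    · exfalso
      subst h
      have : 0 < inner ℝ (x : EuclideanSpace ℝ (Fin 3)) (-z) := hy
      have hz' : 0 < inner ℝ (x : EuclideanSpace ℝ (Fin 3)) z := hz
      rw [inner_neg_right] at this
      linarith
  · exact isOpenMap_proj.comp hU.isOpenMap_subtype_val

instance : PreconnectedSpace Sphere2 :=
  isPreconnected_iff_preconnectedSpace.1 (isPreconnected_sphere (by
    rw [← Module.finrank_eq_rank]; norm_num) _ _)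

instance : Nonempty Sphere2 := (NormedSpace.sphere_nonempty.2 zero_le_one).to_subtype

/-- Stereographic projection from one of the removed points reduces this to the complement of a
finite set in a real vector space of dimension two. -/
theorem isPreconnected_compl_finite_sphere {P : Set Sphere2} (hP : P.Finite) :
    IsPreconnected Pᶜ := by
  rcases P.eq_empty_or_nonempty with rfl | ⟨a, ha⟩
  · simpa using isPreconnected_univ
  have : Fact (Module.finrank ℝ (EuclideanSpace ℝ (Fin 3)) = 2 + 1) := ⟨by simp⟩
  let e := stereographic' 2 a
  have hs : e.source = {a}ᶜ := stereographic'_source a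
  have ht : e.target = univ := stereographic'_target a
  have : Pᶜ = e.symm '' (e '' (P \ {a}))ᶜ := by
    ext x
    constructor
    · intro hx
      have hxs : x ∈ e.source := by
        rw [hs]; rintro rfl; exact hx ha
      refine ⟨e x, ?_, e.left_inv hxs⟩
      rintro ⟨y, ⟨hy, hya⟩, hyx⟩
      have : y = x := e.injOn (by rw [hs]; exact hya) hxs hyx
      exact hx (this ▸ hy)
    · rintro ⟨w, hw, rfl⟩ hmem
      have hwt : w ∈ e.target := by rw [ht]; trivial
      refine hw ⟨e.symm w, ⟨hmem, ?_⟩, e.right_inv hwt⟩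
      have := e.map_target hwt
      rwa [hs] at this
  rw [this]
  refine IsPreconnected.image ?_ _ (e.continuousOn_symm.mono (by rw [ht]; exact subset_univ _))
  refine (Set.Countable.isConnected_compl_of_one_lt_rank ?_
    ((hP.subset sdiff_subset).image e).countable).isPreconnected
  rw [← Module.finrank_eq_rank]; norm_num

theorem isPreconnected_compl_finite_plane {P : Set RealProjectivePlane} (hP : P.Finite) :
    IsPreconnected Pᶜ := by
  have hfin : (proj ⁻¹' P).Finite := by
    refine hP.preimage' fun b _ => ?_
    obtain ⟨x, rfl⟩ := surjective_proj b
    refine (Set.toFinite {x, -x}).subset fun y hy => ?_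
    exact proj_eq_proj.1 hy
  have : Pᶜ = proj '' (proj ⁻¹' P)ᶜ := by
    rw [← preimage_compl, image_preimage_eq _ surjective_proj]
  rw [this]
  exact (isPreconnected_compl_finite_sphere hfin).image _ continuous_proj.continuousOn

/-- A continuous right inverse of the quotient map does not exist. -/
theorem not_exists_section (s : RealProjectivePlane → Sphere2) (hs : Continuous s)
    (h : ∀ p, proj (s p) = p) [T2Space RealProjectivePlane] : False := by
  -- The value of `s ∘ proj` at `x` is `x` or `-x`. The two closed cases cover the connected sphere
  -- and both occur, at `s (proj x₀)` and at its antipode, so they would have to meet.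
  let A : Set Sphere2 := {x | s (proj x) = x}
  let B : Set Sphere2 := {x | s (proj x) = -x}
  have hA : IsClosed A := isClosed_eq (hs.comp continuous_proj) continuous_id
  have hB : IsClosed B := isClosed_eq (hs.comp continuous_proj) continuous_neg
  obtain ⟨x₀⟩ := (inferInstance : Nonempty Sphere2)
  have hmem : s (proj x₀) ∈ A := by show s (proj (s (proj x₀))) = _; rw [h]
  have hmem' : -s (proj x₀) ∈ B := by
    show s (proj (-s (proj x₀))) = _; rw [proj_neg, h, neg_neg]
  obtain ⟨y, -, hyA, hyB⟩ := isPreconnected_closed_iff.1 (isPreconnected_univ (α := Sphere2)) A B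
    hA hB (fun x _ => by
      have := proj_eq_proj.1 (h (proj x))
      exact this) ⟨_, trivial, hmem⟩ ⟨_, trivial, hmem'⟩
  exact sphere_ne_neg y (hyA.symm.trans hyB)

/-- Small charts of the projective plane, with the origin sent to a given point. -/
theorem exists_chart_plane (p : RealProjectivePlane) {N : Set RealProjectivePlane} (hN : N ∈ 𝓝 p) :
    ∃ ψ : ℂ → RealProjectivePlane, IsOpenEmbedding ψ ∧ ψ 0 = p ∧ range ψ ⊆ N := by
  have : Fact (Module.finrank ℝ (EuclideanSpace ℝ (Fin 3)) = 2 + 1) := ⟨by simp⟩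
  obtain ⟨x, rfl⟩ := surjective_proj p
  let L : ℂ ≃L[ℝ] EuclideanSpace ℝ (Fin 2) := ContinuousLinearEquiv.ofFinrankEq (by simp)
  let e := stereographic' 2 (-x)
  have hs : e.source = {-x}ᶜ := stereographic'_source (-x)
  have ht : e.target = univ := stereographic'_target (-x)
  have hxs : x ∈ e.source := by rw [hs]; exact sphere_ne_neg x
  let c : ℂ := L.symm (e x)
  let φ : ℂ → RealProjectivePlane := fun z => proj (e.symm (L z))
  have hφ0 : φ c = proj x := by simp [φ, c, e.left_inv hxs]
  have hφ : IsLocalHomeomorph φ := by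
    refine isLocalHomeomorph_proj.comp (IsLocalHomeomorph.comp (g := e.symm) ?_ L.toHomeomorph.isLocalHomeomorph)
    exact (e.symm.isOpenEmbedding ht).isLocalHomeomorph
  obtain ⟨ε, hcε, hε⟩ := hφ c
  have hV : ε.source ∩ φ ⁻¹' N ∈ 𝓝 c :=
    Filter.inter_mem (ε.open_source.mem_nhds hcε) (hφ.continuous.continuousAt (hφ0 ▸ hN))
  obtain ⟨r, hr, hball⟩ := Metric.mem_nhds_iff.1 hV
  -- Rescaling all of `ℂ` onto a small ball makes the chart total, injective and contained in `N`,
  -- with `0` sent to the centre.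
  let b := OpenPartialHomeomorph.univBall c r
  have hbs : b.source = univ := OpenPartialHomeomorph.univBall_source c r
  have hbt : b.target = Metric.ball c r := OpenPartialHomeomorph.univBall_target c hr
  have hbo : IsOpenEmbedding b := b.isOpenEmbedding hbs
  have hbmem : ∀ z, b z ∈ Metric.ball c r := fun z => hbt ▸ b.map_source (by rw [hbs]; trivial)
  refine ⟨φ ∘ b, ?_, ?_, ?_⟩
  · refine .of_continuous_injective_isOpenMap (hφ.continuous.comp hbo.continuous) ?_
      (hφ.isOpenMap.comp hbo.isOpenMap)
    intro z w hzw
    refine hbo.injective (ε.injOn (hball (hbmem z)).1 (hball (hbmem w)).1 ?_)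
    rw [← hε]
    exact hzw
  · simp [b, OpenPartialHomeomorph.univBall_apply_zero, hφ0]
  · rintro _ ⟨z, rfl⟩
    exact (hball (hbmem z)).2

/-! ### The nine-vertex complex as the subdivided octahedron modulo the antipodal map. -/

/-- The barycentric coordinate, before normalization, of a coordinate axis in the subdivided
octahedron. -/
noncomputable def axisWeight (X Y Z : ℝ) : ℝ := max (|X| - |Y| - |Z|) 0

/-- The barycentric coordinate, before normalization, of the midpoint of an edge of the octahedron
joining the first two positive half axes. -/
noncomputable def pairWeight (X Y Z : ℝ) : ℝ :=
  max 0 (min (|X + Y| - |X - Y|) (|X| + |Y| - |Z|))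

/-- Barycentric coordinates, before normalization, in the octahedron with subdivided facets, modulo
the antipodal map. -/
noncomputable def weight (X Y Z : ℝ) : Fin 9 → ℝ :=
  -- Vertices `0`, `5`, `8` are the axes. The other six are the edge midpoints up to sign: `1, 2`
  -- for `YZ`, `3, 4` for `XZ`, `6, 7` for `XY`, where the second of each pair belongs to opposite
  -- signs.
  ![axisWeight X Y Z, pairWeight Y Z X, pairWeight Y (-Z) X, pairWeight X Z Y, pairWeight X (-Z) Y,
    axisWeight Y X Z, pairWeight X Y Z, pairWeight X (-Y) Z, axisWeight Z X Y]

theorem axisWeight_of_nonneg {a b c : ℝ} (ha : 0 ≤ a) (hb : 0 ≤ b) (hc : 0 ≤ c) :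
    axisWeight a b c = max (a - b - c) 0 := by
  simp [axisWeight, abs_of_nonneg, *]

theorem pairWeight_of_nonneg {a b c : ℝ} (ha : 0 ≤ a) (hb : 0 ≤ b) (hc : 0 ≤ c) :
    pairWeight a b c = max 0 (min (2 * min a b) (a + b - c)) := by
  have : |a + b| - |a - b| = 2 * min a b := by
    rw [abs_of_nonneg (add_nonneg ha hb)]
    rcases le_total a b with h | h
    · rw [abs_of_nonpos (by linarith), min_eq_left h]; ring
    · rw [abs_of_nonneg (by linarith), min_eq_right h]; ring
  rw [pairWeight, this, abs_of_nonneg ha, abs_of_nonneg hb, abs_of_nonneg hc]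

theorem pairWeight_neg_right {a b c : ℝ} (ha : 0 ≤ a) (hb : 0 ≤ b) : pairWeight a (-b) c = 0 := by
  refine max_eq_left ((min_le_left _ _).trans ?_)
  rw [sub_neg_eq_add, abs_of_nonneg (add_nonneg ha hb), sub_nonpos]
  exact abs_le.2 ⟨by linarith, by linarith⟩

@[simp] theorem pairWeight_neg_neg (X Y Z : ℝ) : pairWeight (-X) (-Y) Z = pairWeight X Y Z := by
  rw [pairWeight, pairWeight, ← neg_add, abs_neg, neg_sub_neg, abs_sub_comm, abs_neg, abs_neg]

@[simp] theorem pairWeight_neg_third (X Y Z : ℝ) : pairWeight X Y (-Z) = pairWeight X Y Z := by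
  simp [pairWeight]

theorem pairWeight_neg_left (X Y Z : ℝ) : pairWeight (-X) Y Z = pairWeight X (-Y) Z := by
  rw [← pairWeight_neg_neg, neg_neg]

@[simp] theorem axisWeight_neg_first (X Y Z : ℝ) : axisWeight (-X) Y Z = axisWeight X Y Z := by
  simp [axisWeight]

@[simp] theorem axisWeight_neg_second (X Y Z : ℝ) : axisWeight X (-Y) Z = axisWeight X Y Z := by
  simp [axisWeight]

@[simp] theorem axisWeight_neg_third (X Y Z : ℝ) : axisWeight X Y (-Z) = axisWeight X Y Z := by
  simp [axisWeight]

theorem pairWeight_nonneg (X Y Z : ℝ) : 0 ≤ pairWeight X Y Z := le_max_left _ _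

theorem axisWeight_nonneg (X Y Z : ℝ) : 0 ≤ axisWeight X Y Z := le_max_right _ _

theorem weight_neg (X Y Z : ℝ) : weight (-X) (-Y) (-Z) = weight X Y Z := by
  simp [weight, pairWeight_neg_left]

theorem weight_nonneg (X Y Z : ℝ) (i : Fin 9) : 0 ≤ weight X Y Z i := by
  fin_cases i <;> simp [weight, pairWeight_nonneg, axisWeight_nonneg]

theorem weight_smul {t : ℝ} (ht : 0 ≤ t) (X Y Z : ℝ) :
    weight (t * X) (t * Y) (t * Z) = t • weight X Y Z := by
  have h1 : ∀ X Y Z : ℝ, axisWeight (t * X) (t * Y) (t * Z) = t * axisWeight X Y Z := by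
    intro X Y Z
    rw [axisWeight, axisWeight, abs_mul, abs_mul, abs_mul, abs_of_nonneg ht,
      mul_max_of_nonneg _ _ ht]
    ring_nf
  have h2 : ∀ X Y Z : ℝ, pairWeight (t * X) (t * Y) (t * Z) = t * pairWeight X Y Z := by
    intro X Y Z
    rw [pairWeight, pairWeight, ← mul_add, ← mul_sub, abs_mul, abs_mul, abs_mul, abs_mul, abs_mul,
      abs_of_nonneg ht, mul_max_of_nonneg _ _ ht, mul_min_of_nonneg _ _ ht]
    ring_nf
  simp [weight, ← mul_neg, h1, h2]

theorem axisWeight_eq_zero {a b c : ℝ} (ha : 0 ≤ a) (hb : 0 ≤ b) (hc : 0 ≤ c) (h : a ≤ b + c) :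
    axisWeight a b c = 0 := by
  rw [axisWeight_of_nonneg ha hb hc]; grind

theorem axisWeight_eq_sub {a b c : ℝ} (ha : 0 ≤ a) (hb : 0 ≤ b) (hc : 0 ≤ c) (h : b + c ≤ a) :
    axisWeight a b c = a - b - c := by
  rw [axisWeight_of_nonneg ha hb hc]; grind

theorem pairWeight_eq_zero {a b c : ℝ} (ha : 0 ≤ a) (hb : 0 ≤ b) (hc : 0 ≤ c) (h : a + b ≤ c) :
    pairWeight a b c = 0 := by
  rw [pairWeight_of_nonneg ha hb hc]; grind

theorem pairWeight_eq_left {a b c : ℝ} (ha : 0 ≤ a) (hb : 0 ≤ b) (hc : 0 ≤ c) (h : a + c ≤ b) :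
    pairWeight a b c = 2 * a := by
  rw [pairWeight_of_nonneg ha hb hc]; grind

theorem pairWeight_eq_right {a b c : ℝ} (ha : 0 ≤ a) (hb : 0 ≤ b) (hc : 0 ≤ c) (h : b + c ≤ a) :
    pairWeight a b c = 2 * b := by
  rw [pairWeight_of_nonneg ha hb hc]; grind

theorem pairWeight_eq_sub {a b c : ℝ} (ha : 0 ≤ a) (hb : 0 ≤ b) (hc : 0 ≤ c) (h₁ : a ≤ b + c)
    (h₂ : b ≤ a + c) (h₃ : c ≤ a + b) : pairWeight a b c = a + b - c := by
  rw [pairWeight_of_nonneg ha hb hc]; grind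

section Octants

variable {a b c : ℝ} (ha : 0 ≤ a) (hb : 0 ≤ b) (hc : 0 ≤ c)
include ha hb hc

theorem weight_pos_pos : weight a b c =
    ![axisWeight a b c, pairWeight b c a, 0, pairWeight a c b, 0,
      axisWeight b a c, pairWeight a b c, 0, axisWeight c a b] := by
  simp [weight, pairWeight_neg_right, *]

theorem weight_neg_pos : weight (-a) b c =
    ![axisWeight a b c, pairWeight b c a, 0, 0, pairWeight a c b,
      axisWeight b a c, 0, pairWeight a b c, axisWeight c a b] := by
  simp [weight, pairWeight_neg_left, pairWeight_neg_right, *]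

theorem weight_pos_neg : weight a (-b) c =
    ![axisWeight a b c, 0, pairWeight b c a, pairWeight a c b, 0,
      axisWeight b a c, 0, pairWeight a b c, axisWeight c a b] := by
  simp [weight, pairWeight_neg_left, pairWeight_neg_right, *]

theorem weight_neg_neg : weight (-a) (-b) c =
    ![axisWeight a b c, 0, pairWeight b c a, 0, pairWeight a c b,
      axisWeight b a c, pairWeight a b c, 0, axisWeight c a b] := by
  simp [weight, pairWeight_neg_left, pairWeight_neg_right, *]

/-- An octant carries one middle triangle, where `a`, `b`, `c` satisfy the triangle inequalities,
and three corner triangles such as `b + c ≤ a`. Each disjunct lists the three of the six local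
vertices that are missing from one of these pieces. -/
theorem octant_weights_sum :
    axisWeight a b c + axisWeight b a c + axisWeight c a b +
      pairWeight b c a + pairWeight a c b + pairWeight a b c = a + b + c ∧
    ((axisWeight a b c = 0 ∧ axisWeight b a c = 0 ∧ axisWeight c a b = 0) ∨
      (axisWeight b a c = 0 ∧ axisWeight c a b = 0 ∧ pairWeight b c a = 0) ∨
      (axisWeight a b c = 0 ∧ axisWeight c a b = 0 ∧ pairWeight a c b = 0) ∨
      (axisWeight a b c = 0 ∧ axisWeight b a c = 0 ∧ pairWeight a b c = 0)) := by
  by_cases h1 : b + c ≤ a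
  · rw [axisWeight_eq_sub ha hb hc h1, axisWeight_eq_zero hb ha hc (by linarith),
      axisWeight_eq_zero hc ha hb (by linarith), pairWeight_eq_zero hb hc ha h1,
      pairWeight_eq_right ha hc hb (by linarith), pairWeight_eq_right ha hb hc h1]
    exact ⟨by ring, by simp⟩
  by_cases h2 : a + c ≤ b
  · rw [axisWeight_eq_zero ha hb hc (by linarith), axisWeight_eq_sub hb ha hc h2,
      axisWeight_eq_zero hc ha hb (by linarith), pairWeight_eq_right hb hc ha (by linarith),
      pairWeight_eq_zero ha hc hb h2, pairWeight_eq_left ha hb hc h2]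
    exact ⟨by ring, by simp⟩
  by_cases h3 : a + b ≤ c
  · rw [axisWeight_eq_zero ha hb hc (by linarith), axisWeight_eq_zero hb ha hc (by linarith),
      axisWeight_eq_sub hc ha hb h3, pairWeight_eq_left hb hc ha (by linarith),
      pairWeight_eq_left ha hc hb h3, pairWeight_eq_zero ha hb hc h3]
    exact ⟨by ring, by simp⟩
  push Not at h1 h2 h3
  rw [axisWeight_eq_zero ha hb hc (by linarith), axisWeight_eq_zero hb ha hc (by linarith),
    axisWeight_eq_zero hc ha hb (by linarith),
    pairWeight_eq_sub hb hc ha (by linarith) (by linarith) (by linarith),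
    pairWeight_eq_sub ha hc hb (by linarith) (by linarith) (by linarith),
    pairWeight_eq_sub ha hb hc (by linarith) (by linarith) (by linarith)]
  exact ⟨by ring, by simp⟩

end Octants

theorem octant_weights_surj {A B C P Q R : ℝ} (hA : 0 ≤ A) (hB : 0 ≤ B) (hC : 0 ≤ C) (hP : 0 ≤ P)
    (hQ : 0 ≤ Q) (hR : 0 ≤ R)
    (h : (A = 0 ∧ B = 0 ∧ C = 0) ∨ (B = 0 ∧ C = 0 ∧ P = 0) ∨ (A = 0 ∧ C = 0 ∧ Q = 0) ∨
      (A = 0 ∧ B = 0 ∧ R = 0)) :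
    ∃ a b c : ℝ, 0 ≤ a ∧ 0 ≤ b ∧ 0 ≤ c ∧ axisWeight a b c = A ∧ axisWeight b a c = B ∧
      axisWeight c a b = C ∧ pairWeight b c a = P ∧ pairWeight a c b = Q ∧ pairWeight a b c = R := by
  -- The inverse is linear: an axis vertex contributes its full weight to its coordinate, a midpoint
  -- half of its weight to each of two coordinates.
  have ha : 0 ≤ A + (Q + R) / 2 := by positivity
  have hb : 0 ≤ B + (P + R) / 2 := by positivity
  have hc : 0 ≤ C + (P + Q) / 2 := by positivity
  refine ⟨_, _, _, ha, hb, hc, ?_⟩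
  rcases h with ⟨rfl, rfl, rfl⟩ | ⟨rfl, rfl, rfl⟩ | ⟨rfl, rfl, rfl⟩ | ⟨rfl, rfl, rfl⟩
  · rw [axisWeight_eq_zero ha hb hc (by linarith), axisWeight_eq_zero hb ha hc (by linarith),
      axisWeight_eq_zero hc ha hb (by linarith),
      pairWeight_eq_sub hb hc ha (by linarith) (by linarith) (by linarith),
      pairWeight_eq_sub ha hc hb (by linarith) (by linarith) (by linarith),
      pairWeight_eq_sub ha hb hc (by linarith) (by linarith) (by linarith)]
    exact ⟨rfl, rfl, rfl, by ring, by ring, by ring⟩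
  · rw [axisWeight_eq_sub ha hb hc (by linarith), axisWeight_eq_zero hb ha hc (by linarith),
      axisWeight_eq_zero hc ha hb (by linarith), pairWeight_eq_zero hb hc ha (by linarith),
      pairWeight_eq_right ha hc hb (by linarith), pairWeight_eq_right ha hb hc (by linarith)]
    exact ⟨by ring, rfl, rfl, rfl, by ring, by ring⟩
  · rw [axisWeight_eq_zero ha hb hc (by linarith), axisWeight_eq_sub hb ha hc (by linarith),
      axisWeight_eq_zero hc ha hb (by linarith), pairWeight_eq_right hb hc ha (by linarith),
      pairWeight_eq_zero ha hc hb (by linarith), pairWeight_eq_left ha hb hc (by linarith)]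
    exact ⟨rfl, by ring, rfl, by ring, rfl, by ring⟩
  · rw [axisWeight_eq_zero ha hb hc (by linarith), axisWeight_eq_zero hb ha hc (by linarith),
      axisWeight_eq_sub hc ha hb (by linarith), pairWeight_eq_left hb hc ha (by linarith),
      pairWeight_eq_left ha hc hb (by linarith), pairWeight_eq_zero ha hb hc (by linarith)]
    exact ⟨rfl, rfl, by ring, by ring, by ring, rfl⟩

/-- Antipodal invariance of `weight` leaves four of the eight octants. -/
theorem exists_octant (X Y Z : ℝ) : ∃ a b c : ℝ, 0 ≤ a ∧ 0 ≤ b ∧ 0 ≤ c ∧ |X| = a ∧ |Y| = b ∧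
    |Z| = c ∧ (weight X Y Z = weight a b c ∨ weight X Y Z = weight (-a) b c ∨
      weight X Y Z = weight a (-b) c ∨ weight X Y Z = weight (-a) (-b) c) := by
  refine ⟨|X|, |Y|, |Z|, abs_nonneg _, abs_nonneg _, abs_nonneg _, rfl, rfl, rfl, ?_⟩
  have h := weight_neg X Y Z
  rcases abs_choice X with hX | hX <;> rcases abs_choice Y with hY | hY <;>
    rcases abs_choice Z with hZ | hZ <;> rw [hX, hY, hZ] <;> simp [← h]

theorem sum_weight (X Y Z : ℝ) : ∑ i, weight X Y Z i = |X| + |Y| + |Z| := by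
  obtain ⟨a, b, c, ha, hb, hc, h1, h2, h3, h⟩ := exists_octant X Y Z
  have hs := (octant_weights_sum ha hb hc).1
  rw [h1, h2, h3, ← hs]
  rcases h with h | h | h | h <;> rw [h] <;>
    simp only [weight_pos_pos, weight_neg_pos, weight_pos_neg, weight_neg_neg, ha, hb, hc,
      Fin.sum_univ_succ] <;> simp [Fin.succ] <;> ring

theorem weight_support (X Y Z : ℝ) : ∃ F ∈ facetsRP2, ∀ i, i ∉ F → weight X Y Z i = 0 := by
  obtain ⟨a, b, c, ha, hb, hc, -, -, -, h⟩ := exists_octant X Y Z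
  have hs := (octant_weights_sum ha hb hc).2
  rcases h with h | h | h | h <;> rw [h]
  · rw [weight_pos_pos ha hb hc]
    rcases hs with ⟨h1, h2, h3⟩ | ⟨h1, h2, h3⟩ | ⟨h1, h2, h3⟩ | ⟨h1, h2, h3⟩ <;> rw [h1, h2, h3]
    · exact ⟨{1, 3, 6}, by decide, fun i => by fin_cases i <;> simp⟩
    · exact ⟨{0, 3, 6}, by decide, fun i => by fin_cases i <;> simp⟩
    · exact ⟨{1, 5, 6}, by decide, fun i => by fin_cases i <;> simp⟩
    · exact ⟨{1, 3, 8}, by decide, fun i => by fin_cases i <;> simp⟩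
  · rw [weight_neg_pos ha hb hc]
    rcases hs with ⟨h1, h2, h3⟩ | ⟨h1, h2, h3⟩ | ⟨h1, h2, h3⟩ | ⟨h1, h2, h3⟩ <;> rw [h1, h2, h3]
    · exact ⟨{1, 4, 7}, by decide, fun i => by fin_cases i <;> simp⟩
    · exact ⟨{0, 4, 7}, by decide, fun i => by fin_cases i <;> simp⟩
    · exact ⟨{1, 5, 7}, by decide, fun i => by fin_cases i <;> simp⟩
    · exact ⟨{1, 4, 8}, by decide, fun i => by fin_cases i <;> simp⟩
  · rw [weight_pos_neg ha hb hc]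
    rcases hs with ⟨h1, h2, h3⟩ | ⟨h1, h2, h3⟩ | ⟨h1, h2, h3⟩ | ⟨h1, h2, h3⟩ <;> rw [h1, h2, h3]
    · exact ⟨{2, 3, 7}, by decide, fun i => by fin_cases i <;> simp⟩
    · exact ⟨{0, 3, 7}, by decide, fun i => by fin_cases i <;> simp⟩
    · exact ⟨{2, 5, 7}, by decide, fun i => by fin_cases i <;> simp⟩
    · exact ⟨{2, 3, 8}, by decide, fun i => by fin_cases i <;> simp⟩
  · rw [weight_neg_neg ha hb hc]
    rcases hs with ⟨h1, h2, h3⟩ | ⟨h1, h2, h3⟩ | ⟨h1, h2, h3⟩ | ⟨h1, h2, h3⟩ <;> rw [h1, h2, h3]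
    · exact ⟨{2, 4, 6}, by decide, fun i => by fin_cases i <;> simp⟩
    · exact ⟨{0, 4, 6}, by decide, fun i => by fin_cases i <;> simp⟩
    · exact ⟨{2, 5, 6}, by decide, fun i => by fin_cases i <;> simp⟩
    · exact ⟨{2, 4, 8}, by decide, fun i => by fin_cases i <;> simp⟩

/-- The triple `j` names the midpoint vertices of one of the four octants. A facet lies in that
octant, either as its middle triangle or as one of its corners; the alternatives match those of
`octant_weights_surj`. -/
theorem octant_eq_of_facet : ∀ F ∈ facetsRP2, ∃ j ∈ ({(1, 3, 6), (1, 4, 7), (2, 3, 7), (2, 4, 6)} :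
      Finset (Fin 9 × Fin 9 × Fin 9)),
      (∀ i ∈ F, i = 0 ∨ i = 5 ∨ i = 8 ∨ i = j.1 ∨ i = j.2.1 ∨ i = j.2.2) ∧
      ((0 ∉ F ∧ 5 ∉ F ∧ 8 ∉ F) ∨ (5 ∉ F ∧ 8 ∉ F ∧ j.1 ∉ F) ∨ (0 ∉ F ∧ 8 ∉ F ∧ j.2.1 ∉ F) ∨
        (0 ∉ F ∧ 5 ∉ F ∧ j.2.2 ∉ F)) := by
  decide +kernel

theorem weight_surj (x : Fin 9 → ℝ) (hx : ∀ i, 0 ≤ x i) {F : Finset (Fin 9)} (hF : F ∈ facetsRP2)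
    (h : ∀ i, i ∉ F → x i = 0) : ∃ X Y Z : ℝ, weight X Y Z = x := by
  obtain ⟨⟨j₁, j₂, j₃⟩, hj, hsub, hz⟩ := octant_eq_of_facet F hF
  have hz' : (x 0 = 0 ∧ x 5 = 0 ∧ x 8 = 0) ∨ (x 5 = 0 ∧ x 8 = 0 ∧ x j₁ = 0) ∨
      (x 0 = 0 ∧ x 8 = 0 ∧ x j₂ = 0) ∨ (x 0 = 0 ∧ x 5 = 0 ∧ x j₃ = 0) := by
    rcases hz with hz | hz | hz | hz <;> simp [h _ hz.1, h _ hz.2.1, h _ hz.2.2]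
  obtain ⟨a, b, c, ha, hb, hc, h1, h2, h3, h4, h5, h6⟩ :=
    octant_weights_surj (hx 0) (hx 5) (hx 8) (hx j₁) (hx j₂) (hx j₃) hz'
  have hx0 : ∀ i, ¬(i = 0 ∨ i = 5 ∨ i = 8 ∨ i = j₁ ∨ i = j₂ ∨ i = j₃) → x i = 0 :=
    fun i hi => h i fun hiF => hi (hsub i hiF)
  simp only [Finset.mem_insert, Finset.mem_singleton, Prod.mk.injEq] at hj
  rcases hj with ⟨rfl, rfl, rfl⟩ | ⟨rfl, rfl, rfl⟩ | ⟨rfl, rfl, rfl⟩ | ⟨rfl, rfl, rfl⟩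
  · refine ⟨a, b, c, ?_⟩
    rw [weight_pos_pos ha hb hc, h1, h2, h3, h4, h5, h6]
    ext i; fin_cases i <;> first | rfl | exact (hx0 _ (by decide)).symm
  · refine ⟨-a, b, c, ?_⟩
    rw [weight_neg_pos ha hb hc, h1, h2, h3, h4, h5, h6]
    ext i; fin_cases i <;> first | rfl | exact (hx0 _ (by decide)).symm
  · refine ⟨a, -b, c, ?_⟩
    rw [weight_pos_neg ha hb hc, h1, h2, h3, h4, h5, h6]
    ext i; fin_cases i <;> first | rfl | exact (hx0 _ (by decide)).symm
  · refine ⟨-a, -b, c, ?_⟩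
    rw [weight_neg_neg ha hb hc, h1, h2, h3, h4, h5, h6]
    ext i; fin_cases i <;> first | rfl | exact (hx0 _ (by decide)).symm

/-- This is the first coordinate of the point with these weights: the axis vertex counts fully and
the midpoints involving `X` count by half, the sign of the partner being irrelevant. -/
theorem abs_eq_of_weights (X Y Z : ℝ) :
    |X| = axisWeight X Y Z + (pairWeight X Z Y + pairWeight X (-Z) Y +
      (pairWeight X Y Z + pairWeight X (-Y) Z)) / 2 := by
  have key : ∀ X Y Z : ℝ, pairWeight X Y Z + pairWeight X (-Y) Z = pairWeight |X| |Y| |Z| := by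
    intro X Y Z
    have := pairWeight_neg_right (c := |Z|) (abs_nonneg X) (abs_nonneg Y)
    rcases abs_choice X with hX | hX <;> rcases abs_choice Y with hY | hY <;>
      rcases abs_choice Z with hZ | hZ <;> rw [hX, hY, hZ] at this ⊢ <;>
      simp_all [pairWeight_neg_left]
  have h4 : axisWeight X Y Z = axisWeight |X| |Y| |Z| := by simp [axisWeight]
  rw [key, key, h4]
  have ha := abs_nonneg X
  have hb := abs_nonneg Y
  have hc := abs_nonneg Z
  rw [axisWeight_of_nonneg ha hb hc, pairWeight_of_nonneg ha hc hb, pairWeight_of_nonneg ha hb hc]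
  grind

/-- If the weights of `(X, Y)` and `(X, -Y)` relative to `Z` agree, one of three degeneracies
occurs. -/
theorem degenerate_of_pairWeight_eq {X Y Z : ℝ} (h : pairWeight X Y Z = pairWeight X (-Y) Z) :
    X = 0 ∨ Y = 0 ∨ |X| + |Y| ≤ |Z| := by
  unfold pairWeight at h
  grind

/-- The absolute values are recovered by `abs_eq_of_weights`. Changing the relative sign of two
coordinates swaps two pair weights, so if the weights agree one of the degeneracies holds for each
changed pair; jointly these leave only the identity and the antipode. -/
theorem weight_injective {X Y Z X' Y' Z' : ℝ} (h : weight X Y Z = weight X' Y' Z') :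
    (X = X' ∧ Y = Y' ∧ Z = Z') ∨ (X = -X' ∧ Y = -Y' ∧ Z = -Z') := by
  have e0 : axisWeight X Y Z = axisWeight X' Y' Z' := congrFun h 0
  have e1 : pairWeight Y Z X = pairWeight Y' Z' X' := congrFun h 1
  have e2 : pairWeight Y (-Z) X = pairWeight Y' (-Z') X' := congrFun h 2
  have e3 : pairWeight X Z Y = pairWeight X' Z' Y' := congrFun h 3
  have e4 : pairWeight X (-Z) Y = pairWeight X' (-Z') Y' := congrFun h 4
  have e5 : axisWeight Y X Z = axisWeight Y' X' Z' := congrFun h 5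
  have e6 : pairWeight X Y Z = pairWeight X' Y' Z' := congrFun h 6
  have e7 : pairWeight X (-Y) Z = pairWeight X' (-Y') Z' := congrFun h 7
  have e8 : axisWeight Z X Y = axisWeight Z' X' Y' := congrFun h 8
  have comm : ∀ X Y Z : ℝ, pairWeight X Y Z = pairWeight Y X Z := by
    intro X Y Z
    rw [pairWeight, pairWeight, add_comm X, abs_sub_comm X, add_comm |X|]
  have comm' : ∀ X Y Z : ℝ, pairWeight X (-Y) Z = pairWeight Y (-X) Z := by
    intro X Y Z
    rw [comm, pairWeight_neg_left]
  have hX : |X| = |X'| := by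
    rw [abs_eq_of_weights X Y Z, abs_eq_of_weights X' Y' Z', e0, e3, e4, e6, e7]
  have hY : |Y| = |Y'| := by
    rw [abs_eq_of_weights Y X Z, abs_eq_of_weights Y' X' Z', e5, e1, e2, comm Y X, comm Y' X',
      comm' Y X, comm' Y' X', e6, e7]
  have hZ : |Z| = |Z'| := by
    rw [abs_eq_of_weights Z X Y, abs_eq_of_weights Z' X' Y', e8, comm Z Y, comm Z' Y', comm' Z Y,
      comm' Z' Y', comm Z X, comm Z' X', comm' Z X, comm' Z' X', e1, e2, e3, e4]
  rw [abs_eq_abs] at hX hY hZ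
  have d1 := @degenerate_of_pairWeight_eq X Y Z
  have d2 := @degenerate_of_pairWeight_eq X Z Y
  have d3 := @degenerate_of_pairWeight_eq Y Z X
  rcases hX with rfl | rfl <;> rcases hY with rfl | rfl <;> rcases hZ with rfl | rfl <;>
    simp only [pairWeight_neg_left, pairWeight_neg_third, neg_neg, abs_neg] at * <;> grind

theorem sum_abs_pos (x : Sphere2) : 0 < |x.1 0| + |x.1 1| + |x.1 2| := by
  by_contra h
  have h0 : x.1 0 = 0 := abs_eq_zero.1 (by
    linarith [abs_nonneg (x.1 0), abs_nonneg (x.1 1), abs_nonneg (x.1 2)])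
  have h1 : x.1 1 = 0 := abs_eq_zero.1 (by
    linarith [abs_nonneg (x.1 0), abs_nonneg (x.1 1), abs_nonneg (x.1 2)])
  have h2 : x.1 2 = 0 := abs_eq_zero.1 (by
    linarith [abs_nonneg (x.1 0), abs_nonneg (x.1 1), abs_nonneg (x.1 2)])
  have hx : x.1 = 0 := by ext i; fin_cases i <;> simp [h0, h1, h2]
  have h3 : ‖x.1‖ = 1 := by simp
  rw [hx] at h3
  simp at h3

/-- The map from the sphere to barycentric coordinates. -/
noncomputable def sphereToDelta (x : Sphere2) : Fin 9 → ℝ :=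
  (|x.1 0| + |x.1 1| + |x.1 2|)⁻¹ • weight (x.1 0) (x.1 1) (x.1 2)

theorem continuous_sphereToDelta : Continuous sphereToDelta := by
  have hc : ∀ i, Continuous fun x : Sphere2 => x.1 i := fun i => by fun_prop
  have h0 := hc 0
  have h1 := hc 1
  have h2 := hc 2
  refine Continuous.smul (Continuous.inv₀ (by fun_prop) fun x => (sum_abs_pos x).ne') ?_
  refine continuous_pi fun i => ?_
  fin_cases i <;> simp only [weight, axisWeight, pairWeight] <;> simp <;> fun_prop

theorem sphereToDelta_mem (x : Sphere2) : sphereToDelta x ∈ realizationSet deltaRP2 := by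
  have hpos := sum_abs_pos x
  refine ⟨⟨fun i => mul_nonneg (inv_nonneg.2 hpos.le) (weight_nonneg _ _ _ i), ?_⟩, ?_⟩
  · simp only [sphereToDelta, Pi.smul_apply, smul_eq_mul, ← Finset.mul_sum, sum_weight]
    exact inv_mul_cancel₀ hpos.ne'
  · obtain ⟨F, hF, h⟩ := weight_support (x.1 0) (x.1 1) (x.1 2)
    have hne : F.Nonempty := by
      revert hF
      clear h
      revert F
      decide +kernel
    refine ⟨F, ⟨hne, F, hF, subset_rfl⟩, fun v hv => ?_⟩
    simp [sphereToDelta, h v hv]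

theorem sphereToDelta_surj {y : Fin 9 → ℝ} (hy : y ∈ realizationSet deltaRP2) :
    ∃ x, sphereToDelta x = y := by
  obtain ⟨⟨hnn, hsum⟩, s, ⟨-, F, hF, hsF⟩, hs⟩ := hy
  obtain ⟨X, Y, Z, h⟩ := weight_surj y hnn hF fun i hi => hs i fun his => hi (hsF his)
  have hn : |X| + |Y| + |Z| = 1 := by rw [← sum_weight, h, hsum]
  let v : EuclideanSpace ℝ (Fin 3) := !₂[X, Y, Z]
  have hv : v ≠ 0 := by
    intro hv
    have h0 : X = 0 := congrFun (congrArg WithLp.ofLp hv) 0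
    have h1 : Y = 0 := congrFun (congrArg WithLp.ofLp hv) 1
    have h2 : Z = 0 := congrFun (congrArg WithLp.ofLp hv) 2
    simp [h0, h1, h2] at hn
  have hpos : 0 < ‖v‖⁻¹ := inv_pos.2 (norm_pos_iff.2 hv)
  refine ⟨⟨‖v‖⁻¹ • v, by simp [norm_smul, hv]⟩, ?_⟩
  have e : weight (‖v‖⁻¹ * X) (‖v‖⁻¹ * Y) (‖v‖⁻¹ * Z) = ‖v‖⁻¹ • y := by
    rw [weight_smul hpos.le, h]
  have e' : |‖v‖⁻¹ * X| + |‖v‖⁻¹ * Y| + |‖v‖⁻¹ * Z| = ‖v‖⁻¹ := by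
    rw [abs_mul, abs_mul, abs_mul, abs_of_pos hpos, ← mul_add, ← mul_add, hn, mul_one]
  show (|‖v‖⁻¹ * X| + |‖v‖⁻¹ * Y| + |‖v‖⁻¹ * Z|)⁻¹ •
    weight (‖v‖⁻¹ * X) (‖v‖⁻¹ * Y) (‖v‖⁻¹ * Z) = y
  rw [e, e', smul_smul, inv_mul_cancel₀ hpos.ne', one_smul]

theorem sphereToDelta_eq_iff {x y : Sphere2} :
    sphereToDelta x = sphereToDelta y ↔ x = y ∨ x = -y := by
  have hx := sum_abs_pos x
  have hy := sum_abs_pos y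
  constructor
  · intro h
    unfold sphereToDelta at h
    rw [← weight_smul (inv_nonneg.2 hx.le), ← weight_smul (inv_nonneg.2 hy.le)] at h
    set p := (|x.1 0| + |x.1 1| + |x.1 2|)⁻¹ with hp
    set q := (|y.1 0| + |y.1 1| + |y.1 2|)⁻¹ with hq
    have hp0 : 0 < p := inv_pos.2 hx
    have hq0 : 0 < q := inv_pos.2 hy
    have hnx : ‖x.1‖ = 1 := by simp
    have hny : ‖y.1‖ = 1 := by simp
    have hpq : ∀ z : Sphere2, p • x.1 = q • z.1 → x = z := by
      intro z hz
      have hnz : ‖z.1‖ = 1 := by simp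
      have := congrArg norm hz
      rw [norm_smul, norm_smul, hnx, hnz, Real.norm_of_nonneg hp0.le, Real.norm_of_nonneg hq0.le,
        mul_one, mul_one] at this
      rw [this] at hz
      exact Subtype.ext (smul_right_injective _ hq0.ne' hz)
    rcases weight_injective h with ⟨h0, h1, h2⟩ | ⟨h0, h1, h2⟩
    · left
      refine hpq y ?_
      ext i; fin_cases i
      exacts [h0, h1, h2]
    · right
      refine hpq (-y) ?_
      ext i; fin_cases i
      · simpa using h0
      · simpa using h1
      · simpa using h2
  · rintro (rfl | rfl)
    · rfl
    · simp [sphereToDelta, weight_neg]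

/-- The projective plane maps to the realization of its nine-vertex triangulation. -/
noncomputable def planeToDelta : RealProjectivePlane → Realization deltaRP2 :=
  Quotient.lift (fun x => ⟨sphereToDelta x, sphereToDelta_mem x⟩) fun _ _ h =>
    Subtype.ext (sphereToDelta_eq_iff.2 h)

instance : CompactSpace RealProjectivePlane := Quotient.compactSpace

/-- A continuous bijection from a compact space to a Hausdorff space is a homeomorphism. -/
theorem triangulates_deltaRP2 : Triangulates deltaRP2 RealProjectivePlane := by
  have hc : Continuous planeToDelta :=
    Continuous.quotient_lift (continuous_sphereToDelta.subtype_mk sphereToDelta_mem) _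
  have hb : Function.Bijective planeToDelta := by
    constructor
    · intro p q h
      obtain ⟨x, rfl⟩ := surjective_proj p
      obtain ⟨y, rfl⟩ := surjective_proj q
      exact proj_eq_proj.2 (sphereToDelta_eq_iff.1 (congrArg Subtype.val h))
    · rintro ⟨y, hy⟩
      obtain ⟨x, hx⟩ := sphereToDelta_surj hy
      exact ⟨proj x, Subtype.ext hx⟩
  exact ⟨(Continuous.homeoOfEquivCompactToT2 (f := Equiv.ofBijective _ hb) hc).symm⟩

/-- The Hausdorff property is pulled back from the realization, a subspace of a Euclidean space. -/
instance : T2Space RealProjectivePlane :=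
  let ⟨e⟩ := triangulates_deltaRP2
  e.symm.isEmbedding.t2Space

/-! ### Lifts through coverings, continuous logarithms and winding numbers. -/

theorem isCoveringMap_proj : IsCoveringMap proj :=
  (isLocalHomeomorph_iff_isCoveringMap).1 isLocalHomeomorph_proj

/-- A map from a star-shaped set lifts through every covering map. -/
theorem exists_lift_of_starConvex {F X E : Type*} [AddCommGroup F] [Module ℝ F] [TopologicalSpace F]
    [ContinuousAdd F] [ContinuousSMul ℝ F] [TopologicalSpace X] [TopologicalSpace E] {p : E → X}
    (hp : IsCoveringMap p) {S : Set F} {q : F} (hq : q ∈ S) (hS : StarConvex ℝ q S) (f : C(S, X))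
    {e : E} (he : p e = f ⟨q, hq⟩) : ∃ L : C(S, E), (∀ x, p (L x) = f x) ∧ L ⟨q, hq⟩ = e := by
  have hmem : ∀ z : unitInterval × S, (1 - (z.1 : ℝ)) • q + (z.1 : ℝ) • (z.2 : F) ∈ S := fun z =>
    hS z.2.2 (sub_nonneg.2 z.1.2.2) z.1.2.1 (by ring)
  -- The contraction of `S` to `q` is lifted from the constant `e` at time `0`; its end at time `1`
  -- is the required lift of `f`.
  let H : C(unitInterval × S, X) :=
    ⟨fun z => f ⟨_, hmem z⟩, f.continuous.comp (Continuous.subtype_mk (by fun_prop) _)⟩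
  have H0 : ∀ a, H (0, a) = p (ContinuousMap.const S e a) := fun a => by simp [H, he]
  have hlift : ∀ z, p (hp.liftHomotopy H (.const S e) H0 z) = H z :=
    congrFun (hp.liftHomotopy_lifts H (.const S e) H0)
  refine ⟨(hp.liftHomotopy H (.const S e) H0).comp ⟨fun a => (1, a), by fun_prop⟩, fun x => ?_, ?_⟩
  · have := hlift (1, x)
    simpa [H] using this
  -- Over `q` the contraction is constant, hence so is its lift.
  · let c : unitInterval → E := fun t => hp.liftHomotopy H (.const S e) H0 (t, ⟨q, hq⟩)
    have hc : ∀ t, p (c t) = f ⟨q, hq⟩ := fun t => by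
      refine (hlift _).trans (congrArg f (Subtype.ext ?_))
      show (1 - (t : ℝ)) • q + (t : ℝ) • q = q
      rw [← add_smul, sub_add_cancel, one_smul]
    have h1 : c 1 = c 0 :=
      hp.const_of_comp (g := c) (by fun_prop) (fun t t' => (hc t).trans (hc t').symm) 1 0
    have h0 : c 0 = e := hp.liftHomotopy_zero H (.const S e) H0 ⟨q, hq⟩
    exact h1.trans h0

/-- The function `f` has a continuous logarithm on `S`. -/
def HasLogOn {X : Type*} [TopologicalSpace X] (f : X → ℂ) (S : Set X) : Prop :=
  ∃ L : X → ℂ, ContinuousOn L S ∧ ∀ x ∈ S, Complex.exp (L x) = f x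

/-- A logarithm is a lift through the exponential covering of the punctured plane. -/
theorem HasLogOn.of_starConvex {F : Type*} [AddCommGroup F] [Module ℝ F] [TopologicalSpace F]
    [ContinuousAdd F] [ContinuousSMul ℝ F] {S : Set F} {q : F} (hq : q ∈ S)
    (hS : StarConvex ℝ q S) {f : F → ℂ} (hf : ContinuousOn f S) (h0 : ∀ x ∈ S, f x ≠ 0) :
    HasLogOn f S := by
  classical
  let g : C(S, {z : ℂ // z ≠ 0}) :=
    ⟨fun x => ⟨f x, h0 x x.2⟩, (continuousOn_iff_continuous_domRestrict.1 hf).subtype_mk _⟩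
  obtain ⟨L, hL, -⟩ := exists_lift_of_starConvex Complex.isCoveringMap_exp hq hS g
    (e := Complex.log (f q)) (Subtype.ext (Complex.exp_log (h0 q hq)))
  refine ⟨fun x => if h : x ∈ S then L ⟨x, h⟩ else 0, ?_, fun x hx => ?_⟩
  · rw [continuousOn_iff_continuous_domRestrict]
    convert L.continuous using 1
    ext x
    simp
  · simp only [hx, dif_pos]
    exact congrArg Subtype.val (hL ⟨x, hx⟩)

/-- Two continuous logarithms of a function on a preconnected set agree as soon as they agree at a
point. -/
theorem eqOn_of_exp_eqOn {X : Type*} [TopologicalSpace X] {S : Set X} (hS : IsPreconnected S)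
    {L M : X → ℂ} (hL : ContinuousOn L S) (hM : ContinuousOn M S)
    (h : ∀ x ∈ S, Complex.exp (L x) = Complex.exp (M x)) {a : X} (ha : a ∈ S) (hLM : L a = M a) :
    EqOn L M S :=
  Complex.isCoveringMap_exp.eqOn_of_comp_eqOn hS hL hM (fun x hx => Subtype.ext (h x hx)) ha hLM

theorem HasLogOn.glue {X : Type*} [TopologicalSpace X] {f : X → ℂ} {S A B : Set X}
    (hA : IsClosed A) (hB : IsClosed B) (hSAB : S ⊆ A ∪ B) (hfA : HasLogOn f (S ∩ A))
    (hfB : HasLogOn f (S ∩ B)) (hc : IsPreconnected (S ∩ (A ∩ B))) : HasLogOn f S := by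
  classical
  obtain ⟨L, hL, hLf⟩ := hfA
  obtain ⟨M, hM, hMf⟩ := hfB
  obtain ⟨M', hM', hMf', hLM⟩ : ∃ M' : X → ℂ, ContinuousOn M' (S ∩ B) ∧
      (∀ x ∈ S ∩ B, Complex.exp (M' x) = f x) ∧ ∀ x ∈ S ∩ (A ∩ B), L x = M' x := by
    rcases (S ∩ (A ∩ B)).eq_empty_or_nonempty with he | ⟨a, ha⟩
    · exact ⟨M, hM, hMf, by simp [he]⟩
    -- At a common point the two logarithms differ by a period. Adding it to `M` makes them agree
    -- there, and then on the whole preconnected intersection.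
    have hexp : Complex.exp (L a - M a) = 1 := by
      rw [Complex.exp_sub, hLf a ⟨ha.1, ha.2.1⟩, hMf a ⟨ha.1, ha.2.2⟩, div_self]
      rw [← hLf a ⟨ha.1, ha.2.1⟩]
      exact Complex.exp_ne_zero _
    refine ⟨fun x => M x + (L a - M a), hM.add continuousOn_const, fun x hx => ?_, ?_⟩
    · rw [Complex.exp_add, hexp, mul_one, hMf x hx]
    · refine eqOn_of_exp_eqOn hc (hL.mono fun x hx => ⟨hx.1, hx.2.1⟩)
        ((hM.mono fun x hx => ⟨hx.1, hx.2.2⟩).add continuousOn_const) (fun x hx => ?_) ha (by ring)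
      rw [Complex.exp_add, hexp, mul_one, hMf x ⟨hx.1, hx.2.2⟩, hLf x ⟨hx.1, hx.2.1⟩]
  have e1 : EqOn (A.piecewise L M') L (S ∩ A) := fun x hx => piecewise_eq_of_mem _ _ _ hx.2
  have e2 : EqOn (A.piecewise L M') M' (S ∩ B) := fun x hx => by
    by_cases hxA : x ∈ A
    · rw [piecewise_eq_of_mem _ _ _ hxA]; exact hLM x ⟨hx.1, hxA, hx.2⟩
    · rw [piecewise_eq_of_notMem _ _ _ hxA]
  have hS : S = (S ∩ A) ∪ (S ∩ B) := by
    rw [← inter_union_distrib_left, inter_eq_left.2 hSAB]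
  have aux : ∀ (T : Set X) (N : X → ℂ), IsClosed T → ContinuousOn N (S ∩ T) → ∀ x ∈ S,
      ContinuousWithinAt N (S ∩ T) x := by
    intro T N hT hN x hx
    by_cases hxT : x ∈ T
    · exact hN x ⟨hx, hxT⟩
    · refine continuousWithinAt_of_notMem_closure fun h => hxT ?_
      exact hT.closure_subset_iff.2 inter_subset_right h
  refine ⟨A.piecewise L M', ?_, fun x hx => ?_⟩
  · intro x hx
    rw [hS]
    exact (aux A _ hA (hL.congr e1) x hx).union (aux B _ hB (hM'.congr e2) x hx)
  · rcases hSAB hx with h | h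
    · rw [e1 ⟨hx, h⟩, hLf x ⟨hx, h⟩]
    · rw [e2 ⟨hx, h⟩, hMf' x ⟨hx, h⟩]

/-- The loop `u`, of period `1` and without zeros, has winding number `n` around the origin. -/
def IsWinding (u : ℝ → ℂ) (n : ℤ) : Prop :=
  ∃ L : ℝ → ℂ, Continuous L ∧ (∀ t, Complex.exp (L t) = u t) ∧
    ∀ t, L (t + 1) = L t + n * (2 * Real.pi * Complex.I)

theorem IsWinding.unique {u : ℝ → ℂ} {m n : ℤ} (hm : IsWinding u m) (hn : IsWinding u n) :
    m = n := by
  obtain ⟨L, hL, hLu, hLm⟩ := hm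
  obtain ⟨M, hM, hMu, hMn⟩ := hn
  have hexp : Complex.exp (L 0 - M 0) = 1 := by
    rw [Complex.exp_sub, hLu, hMu, div_self]
    rw [← hLu]
    exact Complex.exp_ne_zero _
  have key : EqOn L (fun t => M t + (L 0 - M 0)) univ := by
    refine eqOn_of_exp_eqOn isPreconnected_univ hL.continuousOn
      (hM.add continuous_const).continuousOn (fun t _ => ?_) (mem_univ 0) (by ring)
    rw [Complex.exp_add, hexp, mul_one, hLu, hMu]
  have h1 := key (mem_univ 1)
  have h2 := hLm 0
  have h3 := hMn 0
  simp only [zero_add] at h1 h2 h3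
  have h4 : (m : ℂ) * (2 * Real.pi * Complex.I) = n * (2 * Real.pi * Complex.I) := by
    rw [h2, h3] at h1
    linear_combination h1
  exact_mod_cast mul_right_cancel₀ Complex.two_pi_I_ne_zero h4

/-- A continuous logarithm of a periodic function changes by a constant over a period. -/
theorem exists_period_of_exp_periodic {X : Type*} [TopologicalSpace X] [PreconnectedSpace X]
    [Nonempty X] {L : X → ℂ} (hL : Continuous L) {τ : X → X} (hτ : Continuous τ)
    (h : ∀ x, Complex.exp (L (τ x)) = Complex.exp (L x)) :
    ∃ n : ℤ, ∀ x, L (τ x) = L x + n * (2 * Real.pi * Complex.I) := by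
  obtain ⟨a⟩ := (inferInstance : Nonempty X)
  obtain ⟨n, hn⟩ := Complex.exp_eq_exp_iff_exists_int.1 (h a)
  refine ⟨n, fun x => ?_⟩
  refine eqOn_of_exp_eqOn (M := fun x => L x + n * (2 * Real.pi * Complex.I)) isPreconnected_univ
    (hL.comp hτ).continuousOn (hL.add continuous_const).continuousOn (fun t _ => ?_) (mem_univ a) hn
    (mem_univ x)
  show Complex.exp (L (τ t)) = _
  rw [h, Complex.exp_add, Complex.exp_int_mul_two_pi_mul_I, mul_one]

theorem exists_isWinding {u : ℝ → ℂ} (hu : Continuous u) (h0 : ∀ t, u t ≠ 0)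
    (hp : ∀ t, u (t + 1) = u t) : ∃ n, IsWinding u n := by
  obtain ⟨L, hL, hLu⟩ := HasLogOn.of_starConvex (S := univ) (mem_univ (0 : ℝ))
    (convex_univ.starConvex (mem_univ _)) hu.continuousOn fun t _ => h0 t
  rw [continuousOn_univ] at hL
  obtain ⟨n, hn⟩ := exists_period_of_exp_periodic hL (continuous_add_const (1 : ℝ)) fun t => by
    rw [hLu _ trivial, hLu _ trivial, hp]
  exact ⟨n, L, hL, fun t => hLu t trivial, hn⟩

/-- A self map of the punctured plane multiplies winding numbers by a constant. -/
theorem exists_degree {f : ℂ → ℂ} (hf : ContinuousOn f {0}ᶜ) (h0 : ∀ z ≠ 0, f z ≠ 0) :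
    ∃ d : ℤ, ∀ u n, IsWinding u n → IsWinding (f ∘ u) (n * d) := by
  have hfe : Continuous fun s => f (Complex.exp s) :=
    hf.comp_continuous Complex.continuous_exp fun s => Complex.exp_ne_zero s
  -- `G` is a lift of `f` to the universal coverings of the punctured planes; its increment over
  -- `2πi` is the degree.
  obtain ⟨G, hG, hGf⟩ := HasLogOn.of_starConvex (S := univ) (mem_univ (0 : ℂ))
    (convex_univ.starConvex (mem_univ _)) hfe.continuousOn fun t _ => h0 _ (Complex.exp_ne_zero t)
  rw [continuousOn_univ] at hG
  obtain ⟨d, hd⟩ := exists_period_of_exp_periodic hG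
    (continuous_add_const (2 * Real.pi * Complex.I)) fun s => by
      simp only [hGf _ trivial, Complex.exp_add, Complex.exp_two_pi_mul_I, mul_one]
  have hdn : ∀ (n : ℤ) (s : ℂ), G (s + n * (2 * Real.pi * Complex.I)) =
      G s + (n * d : ℤ) * (2 * Real.pi * Complex.I) := by
    intro n
    induction n using Int.induction_on with
    | zero => simp
    | succ k ih =>
      intro s
      have := hd (s + k * (2 * Real.pi * Complex.I))
      have e : s + ((k + 1 : ℤ) : ℂ) * (2 * Real.pi * Complex.I) =
          s + k * (2 * Real.pi * Complex.I) + 2 * Real.pi * Complex.I := by push_cast; ring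
      rw [e, this]
      have h2 := ih s
      push_cast at h2 ⊢
      rw [h2]; ring
    | pred k ih =>
      intro s
      have := hd (s + (-k - 1 : ℤ) * (2 * Real.pi * Complex.I))
      have e : s + ((-k - 1 : ℤ) : ℂ) * (2 * Real.pi * Complex.I) + 2 * Real.pi * Complex.I =
          s + (-k : ℤ) * (2 * Real.pi * Complex.I) := by push_cast; ring
      rw [e, ih s] at this
      push_cast at this ⊢
      linear_combination -this
  refine ⟨d, ?_⟩
  rintro u n ⟨L, hL, hLu, hLn⟩
  refine ⟨fun t => G (L t), hG.comp hL, fun t => ?_, fun t => ?_⟩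
  · simp only [hGf _ trivial, hLu, Function.comp]
  · show G (L (t + 1)) = _
    rw [hLn, hdn]

theorem isWinding_circle {r : ℝ} (hr : 0 < r) :
    IsWinding (fun t => r * Complex.exp (2 * Real.pi * t * Complex.I)) 1 := by
  refine ⟨fun t => Real.log r + 2 * Real.pi * t * Complex.I, by fun_prop, fun t => ?_, fun t => ?_⟩
  · rw [Complex.exp_add, ← Complex.ofReal_exp, Real.exp_log hr]
  · push_cast; ring

/-- Composing the logarithm with the closed curve gives a periodic logarithm, so the increment is
zero. -/
theorem HasLogOn.isWinding {X : Type*} [TopologicalSpace X] {f : X → ℂ} {S : Set X}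
    (h : HasLogOn f S) {γ : ℝ → X} (hγ : Continuous γ) (hS : ∀ t, γ t ∈ S)
    (hp : ∀ t, γ (t + 1) = γ t) : IsWinding (f ∘ γ) 0 := by
  obtain ⟨L, hL, hLf⟩ := h
  exact ⟨L ∘ γ, hL.comp_continuous hγ hS, fun t => hLf _ (hS t), fun t => by simp [hp]⟩

/-! ### Closed faces, carriers and neighbourhoods in the realization. -/

section Realization

variable {V : Type*} [Fintype V] [DecidableEq V] {Γ : PreAbstractSimplicialComplex V}

theorem mem_faces_of_subset {s t : Finset V} (hs : s ∈ Γ.faces) (hts : t ⊆ s) (ht : t.Nonempty) :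
    t ∈ Γ.faces :=
  (Γ.isRelLowerSet_faces hs).2 hts ht

theorem nonempty_of_mem_faces {s : Finset V} (hs : s ∈ Γ.faces) : s.Nonempty :=
  (Γ.isRelLowerSet_faces hs).1

/-- The geometric realization of a single simplex. -/
def closedFace (s : Finset V) : Set (V → ℝ) := {x | x ∈ stdSimplex ℝ V ∧ ∀ v, v ∉ s → x v = 0}

theorem mem_realizationSet {x : V → ℝ} :
    x ∈ realizationSet Γ ↔ ∃ s ∈ Γ.faces, x ∈ closedFace s :=
  ⟨fun ⟨h, s, hs, h'⟩ => ⟨s, hs, h, h'⟩, fun ⟨s, hs, h, h'⟩ => ⟨h, s, hs, h'⟩⟩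

theorem convex_closedFace (s : Finset V) : Convex ℝ (closedFace s) := by
  refine (convex_stdSimplex ℝ V).inter ?_
  intro x hx y hy a b _ _ _ v hv
  simp [hx v hv, hy v hv]

theorem isClosed_closedFace (s : Finset V) : IsClosed (closedFace s) := by
  refine (isClosed_stdSimplex ℝ V).inter ?_
  have : {x : V → ℝ | ∀ v, v ∉ s → x v = 0} = ⋂ v, ⋂ _ : v ∉ s, {x | x v = 0} := by
    ext; simp
  show IsClosed {x : V → ℝ | ∀ v, v ∉ s → x v = 0}
  rw [this]
  exact isClosed_iInter fun v => isClosed_iInter fun _ =>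
    isClosed_eq (continuous_apply v) continuous_const

theorem closedFace_mono {s t : Finset V} (h : s ⊆ t) : closedFace s ⊆ closedFace t :=
  fun _ hx => ⟨hx.1, fun v hv => hx.2 v fun hvs => hv (h hvs)⟩

/-- The carrier of a point, the set of its nonzero coordinates. -/
noncomputable def carrier (x : V → ℝ) : Finset V := {v | x v ≠ 0}

theorem mem_carrier {x : V → ℝ} {v : V} : v ∈ carrier x ↔ x v ≠ 0 := by simp [carrier]

theorem carrier_subset_iff {x : V → ℝ} (hx : x ∈ stdSimplex ℝ V) {s : Finset V} :
    carrier x ⊆ s ↔ x ∈ closedFace s := by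
  constructor
  · intro h
    refine ⟨hx, fun v hv => ?_⟩
    by_contra h0
    exact hv (h (mem_carrier.2 h0))
  · intro h v hv
    by_contra h0
    exact mem_carrier.1 hv (h.2 v h0)

theorem carrier_nonempty {x : V → ℝ} (hx : x ∈ stdSimplex ℝ V) : (carrier x).Nonempty := by
  by_contra h
  rw [Finset.not_nonempty_iff_eq_empty] at h
  have h0 : ∀ v, x v = 0 := fun v => by
    by_contra h0
    simpa [h] using mem_carrier.2 h0
  simpa [h0] using hx.2

theorem carrier_mem_faces {x : V → ℝ} (hx : x ∈ realizationSet Γ) : carrier x ∈ Γ.faces := by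
  obtain ⟨h, s, hs, h'⟩ := hx
  exact mem_faces_of_subset hs ((carrier_subset_iff h).2 ⟨h, h'⟩) (carrier_nonempty h)

theorem eventually_carrier_subset (p : V → ℝ) : ∀ᶠ x in 𝓝 p, carrier p ⊆ carrier x := by
  have : ∀ v ∈ carrier p, ∀ᶠ x in 𝓝 p, x v ≠ 0 := fun v hv =>
    (continuous_apply v).continuousAt.eventually_ne (mem_carrier.1 hv)
  filter_upwards [(Filter.eventually_all_finset _).2 this] with x hx v hv
  exact mem_carrier.2 (hx v hv)

/-- Near a point, the realization is a simplex if there is a greatest face at that point. -/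
theorem exists_ball_inter_eq {p : V → ℝ} {T : Finset V} (hT : T ∈ Γ.faces)
    (h : ∀ s ∈ Γ.faces, carrier p ⊆ s → s ⊆ T) :
    ∃ r > 0, ∀ r' ≤ r, realizationSet Γ ∩ Metric.ball p r' = closedFace T ∩ Metric.ball p r' := by
  obtain ⟨r, hr, hball⟩ := Metric.eventually_nhds_iff_ball.1 (eventually_carrier_subset p)
  refine ⟨r, hr, fun r' hr' => ?_⟩
  ext x
  constructor
  · rintro ⟨hx, hxr⟩
    have hc := hball x (Metric.ball_subset_ball hr' hxr)
    exact ⟨(carrier_subset_iff hx.1).1 (h _ (carrier_mem_faces hx) hc), hxr⟩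
  · rintro ⟨hx, hxr⟩
    exact ⟨mem_realizationSet.2 ⟨T, hT, hx⟩, hxr⟩

/-- Moving mass `δ` from the vertex `a` to the vertex `c`. -/
noncomputable def shift (p : V → ℝ) (a c : V) (δ : ℝ) : V → ℝ :=
  p + δ • (Pi.single c 1 - Pi.single a 1)

theorem shift_source {p : V → ℝ} {a c : V} (h : a ≠ c) (δ : ℝ) : shift p a c δ a = p a - δ := by
  simp [shift, h, sub_eq_add_neg]

theorem shift_target {p : V → ℝ} {a c : V} (h : a ≠ c) (δ : ℝ) : shift p a c δ c = p c + δ := by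
  simp [shift, h.symm]

theorem shift_other {p : V → ℝ} {a c v : V} (ha : v ≠ a) (hc : v ≠ c) (δ : ℝ) :
    shift p a c δ v = p v := by
  simp [shift, ha, hc]

theorem shift_mem {p : V → ℝ} {T : Finset V} (hp : p ∈ closedFace T) {a c : V} (hac : a ≠ c)
    (ha : a ∈ T) (hc : c ∈ T) {δ : ℝ} (h0 : 0 ≤ δ) (hδ : δ ≤ p a) :
    shift p a c δ ∈ closedFace T := by
  refine ⟨⟨fun v => ?_, ?_⟩, fun v hv => ?_⟩
  · by_cases hva : v = a
    · rw [hva, shift_source hac]; linarith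
    by_cases hvc : v = c
    · rw [hvc, shift_target hac]; linarith [hp.1.1 c]
    · rw [shift_other hva hvc]; exact hp.1.1 v
  · simp [shift, Finset.sum_add_distrib, ← Finset.mul_sum, hp.1.2]
  · rw [shift_other (by rintro rfl; exact hv ha) (by rintro rfl; exact hv hc)]
    exact hp.2 v hv

theorem shift_mem_ball {p : V → ℝ} {a c : V} {δ r : ℝ} (h0 : 0 ≤ δ) (hδ : δ < r) :
    shift p a c δ ∈ Metric.ball p r := by
  rw [Metric.mem_ball, dist_pi_lt_iff (h0.trans_lt hδ)]
  intro v
  have : |δ * ((Pi.single c 1 : V → ℝ) v - (Pi.single a 1 : V → ℝ) v)| ≤ δ := by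
    rw [abs_mul, abs_of_nonneg h0]
    refine mul_le_of_le_one_right h0 ?_
    by_cases h1 : v = c <;> by_cases h2 : v = a <;> simp [h1, h2, Pi.single_apply] <;>
      split_ifs <;> simp
  simp only [shift, Pi.add_apply, Pi.smul_apply, Pi.sub_apply, smul_eq_mul, dist_eq_norm,
    add_sub_cancel_left, Real.norm_eq_abs]
  exact this.trans_lt hδ

end Realization

/-- Removing a boundary point from a convex set leaves a star-shaped set. -/
theorem starConvex_diff_singleton {E : Type*} [AddCommGroup E] [Module ℝ E] {C : Set E}
    (hC : Convex ℝ C) (ℓ : E →ₗ[ℝ] ℝ) {p q : E} (hq : q ∈ C) (hpq : ℓ p < ℓ q)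
    (h : ∀ x ∈ C, ℓ p ≤ ℓ x) : StarConvex ℝ q (C \ {p}) := by
  rintro x ⟨hx, hxp⟩ a b ha hb hab
  refine ⟨hC hq hx ha hb hab, fun he => hxp ?_⟩
  have he' : a • q + b • x = p := he
  have h1 : a * ℓ q + b * ℓ x = ℓ p := by rw [← he']; simp
  have h2 := h x hx
  -- Since `ℓ` is at least `ℓ p` on `C` and larger at `q`, a convex combination equal to `p` can
  -- give no weight to `q`.
  have ha0 : a = 0 := by
    by_contra ha0
    have : 0 < a := lt_of_le_of_ne ha (Ne.symm ha0)
    have hb1 : b = 1 - a := by linarith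
    subst hb1
    nlinarith
  subst ha0
  have hb1 : b = 1 := by linarith
  subst hb1
  simpa using he'

/-! ### Charts of a triangulated plane and the absence of boundary. -/

section Charts

variable {V : Type*} [Fintype V] [DecidableEq V] {Γ : PreAbstractSimplicialComplex V}

theorem exists_chart (hΓ : Triangulates Γ RealProjectivePlane) {p : V → ℝ}
    (hp : p ∈ realizationSet Γ) {U : Set (V → ℝ)} (hU : U ∈ 𝓝 p) :
    ∃ ψ : ℂ → V → ℝ, IsEmbedding ψ ∧ ψ 0 = p ∧ range ψ ⊆ realizationSet Γ ∩ U ∧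
      ∃ r > 0, realizationSet Γ ∩ Metric.ball p r ⊆ range ψ := by
  obtain ⟨e⟩ := hΓ
  have hN : e.symm ⁻¹' (Subtype.val ⁻¹' U) ∈ 𝓝 (e ⟨p, hp⟩) := by
    have he : (Subtype.val ∘ e.symm) (e ⟨p, hp⟩) = p := by simp
    refine (continuous_subtype_val.comp e.symm.continuous).continuousAt ?_
    rw [he]
    exact hU
  obtain ⟨φ, hφ, hφ0, hφN⟩ := exists_chart_plane _ hN
  have ho : IsOpenEmbedding (e.symm ∘ φ) := e.symm.isOpenEmbedding.comp hφ
  refine ⟨Subtype.val ∘ e.symm ∘ φ, IsEmbedding.subtypeVal.comp ho.isEmbedding, by simp [hφ0], ?_, ?_⟩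
  · rintro _ ⟨z, rfl⟩
    exact ⟨(e.symm (φ z)).2, hφN ⟨z, rfl⟩⟩
  · have hnhds : range (e.symm ∘ φ) ∈ 𝓝 (⟨p, hp⟩ : Realization Γ) :=
      ho.isOpen_range.mem_nhds ⟨0, by simp [hφ0]⟩
    obtain ⟨r, hr, hball⟩ := Metric.mem_nhds_iff.1 hnhds
    refine ⟨r, hr, ?_⟩
    rintro x ⟨hx, hxr⟩
    obtain ⟨z, hz⟩ := hball (show (⟨x, hx⟩ : Realization Γ) ∈ Metric.ball _ r from hxr)
    exact ⟨z, congrArg Subtype.val hz⟩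

theorem continuousOn_invFun {X Y : Type*} [TopologicalSpace X] [TopologicalSpace Y] [Nonempty X]
    {f : X → Y} (hf : IsEmbedding f) : ContinuousOn (Function.invFun f) (range f) := by
  rw [continuousOn_iff_continuous_domRestrict]
  refine hf.continuous_iff.2 ?_
  have : f ∘ (range f).domRestrict (Function.invFun f) = Subtype.val := by
    ext ⟨_, z, rfl⟩
    simp [Function.leftInverse_invFun hf.injective z]
  rw [this]
  exact continuous_subtype_val

/-- Around each point of a triangulated projective plane there is a function without a continuous
logarithm off that point. -/
theorem exists_not_hasLogOn (hΓ : Triangulates Γ RealProjectivePlane) {p : V → ℝ}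
    (hp : p ∈ realizationSet Γ) : ∃ f : (V → ℝ) → ℂ, ∃ r > 0,
      ContinuousOn f (realizationSet Γ ∩ Metric.ball p r) ∧
      (∀ x ∈ realizationSet Γ ∩ Metric.ball p r, x ≠ p → f x ≠ 0) ∧
      ∀ r' > 0, r' ≤ r → ¬ HasLogOn f ((realizationSet Γ ∩ Metric.ball p r') \ {p}) := by
  obtain ⟨ψ, hψ, hψ0, hψr, r, hr, hball⟩ := exists_chart hΓ hp Filter.univ_mem
  have hinv : ∀ z, Function.invFun ψ (ψ z) = z := Function.leftInverse_invFun hψ.injective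
  -- The function is the inverse of a chart centred at `p`. On the image of a small circle it has
  -- winding number one, whereas a logarithm would force zero.
  refine ⟨Function.invFun ψ, r, hr, (continuousOn_invFun hψ).mono hball, ?_, ?_⟩
  · intro x hx hxp
    obtain ⟨z, rfl⟩ := hball hx
    rw [hinv]
    rintro rfl
    exact hxp hψ0
  · intro r' hr' _ hlog
    have hpre : ψ ⁻¹' Metric.ball p r' ∈ 𝓝 0 :=
      hψ.continuous.continuousAt (by rw [hψ0]; exact Metric.ball_mem_nhds p hr')
    obtain ⟨ε, hε, hεb⟩ := Metric.mem_nhds_iff.1 hpre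
    let u : ℝ → ℂ := fun t => ((ε / 2 : ℝ) : ℂ) * Complex.exp (2 * Real.pi * t * Complex.I)
    have hu : IsWinding u 1 := isWinding_circle (half_pos hε)
    have hunorm : ∀ t, ‖u t‖ = ε / 2 := fun t => by
      have : (2 * Real.pi * t * Complex.I : ℂ) = ((2 * Real.pi * t : ℝ) : ℂ) * Complex.I := by
        push_cast; ring
      simp only [u]
      rw [norm_mul, this, Complex.norm_exp_ofReal_mul_I, Complex.norm_of_nonneg (half_pos hε).le,
        mul_one]
    have h0 : IsWinding (Function.invFun ψ ∘ (ψ ∘ u)) 0 := by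
      refine hlog.isWinding (hψ.continuous.comp (by fun_prop)) (fun t => ⟨⟨?_, ?_⟩, ?_⟩) fun t => ?_
      · exact (hψr ⟨_, rfl⟩).1
      · refine hεb ?_
        rw [mem_ball_zero_iff, hunorm]
        exact half_lt_self hε
      · intro h
        have : u t = 0 := hψ.injective (hψ0 ▸ h)
        have h' := hunorm t
        rw [this, norm_zero] at h'
        linarith
      · have : u (t + 1) = u t := by
          simp only [u]
          congr 1
          push_cast
          rw [mul_add, add_mul, mul_one, Complex.exp_add, Complex.exp_two_pi_mul_I, mul_one]
        simp [this]
    have he : Function.invFun ψ ∘ (ψ ∘ u) = u := by ext t; simp [hinv]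
    rw [he] at h0
    exact absurd (hu.unique h0) one_ne_zero

/-- A triangulated projective plane has no boundary points. -/
theorem no_boundary (hΓ : Triangulates Γ RealProjectivePlane) {p : V → ℝ} {T : Finset V}
    (hT : T ∈ Γ.faces) (hpT : p ∈ closedFace T) (h : ∀ s ∈ Γ.faces, carrier p ⊆ s → s ⊆ T) {c : V}
    (hc : c ∈ T) (hpc : p c = 0) : False := by
  have hp : p ∈ realizationSet Γ := mem_realizationSet.2 ⟨T, hT, hpT⟩
  obtain ⟨f, r, hr, hf, hf0, hlog⟩ := exists_not_hasLogOn hΓ hp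
  obtain ⟨r', hr', heq⟩ := exists_ball_inter_eq hT h
  obtain ⟨a, ha⟩ := carrier_nonempty hpT.1
  have hpa : 0 < p a := lt_of_le_of_ne (hpT.1.1 a) (Ne.symm (mem_carrier.1 ha))
  have hac : a ≠ c := by rintro rfl; exact hpa.ne' hpc
  set ρ := min r r' with hρ
  have hρ0 : 0 < ρ := lt_min hr hr'
  refine hlog ρ hρ0 (min_le_left _ _) ?_
  have hsub : (realizationSet Γ ∩ Metric.ball p ρ) \ {p} ⊆ realizationSet Γ ∩ Metric.ball p r :=
    sdiff_subset.trans (inter_subset_inter_right _ (Metric.ball_subset_ball (min_le_left _ _)))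
  set δ := min (p a) (ρ / 2) with hδ
  have hδ0 : 0 < δ := lt_min hpa (half_pos hρ0)
  have hδρ : δ < ρ := (min_le_right _ _).trans_lt (half_lt_self hρ0)
  have hq : shift p a c δ ∈ closedFace T ∩ Metric.ball p ρ :=
    ⟨shift_mem hpT hac ((carrier_subset_iff hpT.1).2 hpT ha) hc hδ0.le (min_le_left _ _),
      shift_mem_ball hδ0.le hδρ⟩
  have hqc : shift p a c δ c = δ := by rw [shift_target hac, hpc, zero_add]
  -- The coordinate at `c` attains its minimum zero at `p`. Seen from a nearby point with positive
  -- `c`-coordinate, the punctured neighbourhood is star-shaped and so carries a logarithm.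
  refine HasLogOn.of_starConvex (q := shift p a c δ) ?_ ?_ (hf.mono hsub)
    fun x hx => hf0 x (hsub hx) hx.2
  · rw [heq ρ (min_le_right _ _)]
    refine ⟨hq, fun h => ?_⟩
    have := congrFun (show shift p a c δ = p from h) c
    rw [hqc, hpc] at this
    exact hδ0.ne' this
  · rw [heq ρ (min_le_right _ _)]
    refine starConvex_diff_singleton ((convex_closedFace T).inter (convex_ball p ρ))
      (LinearMap.proj c) hq ?_ fun x hx => ?_
    · simp [hqc, hpc, hδ0]
    · simp [hpc, hx.1.1.1 c]

end Charts

/-! ### Purity, and connectedness through edges. -/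

section Local

variable {V : Type*} [Fintype V] [DecidableEq V] {Γ : PreAbstractSimplicialComplex V}

/-- The barycentre of a face. -/
noncomputable def barycenter (s : Finset V) : V → ℝ := fun v => if v ∈ s then (s.card : ℝ)⁻¹ else 0

theorem barycenter_mem {s : Finset V} (hs : s.Nonempty) : barycenter s ∈ closedFace s := by
  have hcard : (s.card : ℝ) ≠ 0 := by exact_mod_cast hs.card_pos.ne'
  refine ⟨⟨fun v => ?_, ?_⟩, fun v hv => by simp [barycenter, hv]⟩
  · unfold barycenter; positivity
  · simp [barycenter, hcard]

theorem carrier_barycenter {s : Finset V} (hs : s.Nonempty) : carrier (barycenter s) = s := by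
  have hcard : (s.card : ℝ) ≠ 0 := by exact_mod_cast hs.card_pos.ne'
  ext v
  rw [mem_carrier]
  by_cases h : v ∈ s <;> simp [barycenter, h, hs.ne_empty]

/-- A maximal face of a triangulated projective plane has at most three vertices. -/
theorem card_le_three_of_maximal (hΓ : Triangulates Γ RealProjectivePlane) {T : Finset V}
    (hT : T ∈ Γ.faces) (hmax : ∀ s ∈ Γ.faces, T ⊆ s → s ⊆ T) : T.card ≤ 3 := by
  by_contra hcard
  push Not at hcard
  obtain ⟨a, ha, b, hb, c, hc, hab, hac, hbc⟩ := Finset.two_lt_card.1 (show 2 < T.card by omega)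
  obtain ⟨d, hd, hdn⟩ := Finset.exists_mem_notMem_of_card_lt_card
    (show ({a, b, c} : Finset V).card < T.card from Finset.card_le_three.trans_lt hcard)
  simp only [Finset.mem_insert, Finset.mem_singleton, not_or] at hdn
  obtain ⟨hda, hdb, hdc⟩ := hdn
  have hne := nonempty_of_mem_faces hT
  set p := barycenter T with hpdef
  have hpT : p ∈ closedFace T := barycenter_mem hne
  have hcar : carrier p = T := carrier_barycenter hne
  have hpos : ∀ v ∈ T, 0 < p v := fun v hv => lt_of_le_of_ne (hpT.1.1 v)
    (Ne.symm (mem_carrier.1 (by rwa [hcar])))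
  have hp : p ∈ realizationSet Γ := mem_realizationSet.2 ⟨T, hT, hpT⟩
  obtain ⟨f, r, hr, hf, hf0, hlog⟩ := exists_not_hasLogOn hΓ hp
  obtain ⟨r', hr', heq⟩ := exists_ball_inter_eq (p := p) hT (by rwa [hcar])
  set ρ := min r r' with hρ
  have hρ0 : 0 < ρ := lt_min hr hr'
  refine hlog ρ hρ0 (min_le_left _ _) ?_
  have hsub : (realizationSet Γ ∩ Metric.ball p ρ) \ {p} ⊆ realizationSet Γ ∩ Metric.ball p r :=
    sdiff_subset.trans (inter_subset_inter_right _ (Metric.ball_subset_ball (min_le_left _ _)))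
  have hfc := hf.mono hsub
  have hfn : ∀ x ∈ (realizationSet Γ ∩ Metric.ball p ρ) \ {p}, f x ≠ 0 :=
    fun x hx => hf0 x (hsub hx) hx.2
  rw [heq ρ (min_le_right _ _)] at hfc hfn ⊢
  set C := closedFace T ∩ Metric.ball p ρ with hC
  have hCc : Convex ℝ C := (convex_closedFace T).inter (convex_ball p ρ)
  obtain ⟨δ, hδ0, hδa, hδb, hδc, hδρ⟩ : ∃ δ > 0, δ ≤ p a ∧ δ ≤ p b ∧ δ ≤ p c ∧ δ < ρ := by
    refine ⟨min (min (p a) (p b)) (min (p c) (ρ / 2)), ?_, ?_, ?_, ?_, ?_⟩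
    · exact lt_min (lt_min (hpos a ha) (hpos b hb)) (lt_min (hpos c hc) (half_pos hρ0))
    · exact (min_le_left _ _).trans (min_le_left _ _)
    · exact (min_le_left _ _).trans (min_le_right _ _)
    · exact (min_le_right _ _).trans (min_le_left _ _)
    · exact ((min_le_right _ _).trans (min_le_right _ _)).trans_lt (half_lt_self hρ0)
  have hshift : ∀ x y : V, x ≠ y → x ∈ T → y ∈ T → δ ≤ p x → shift p x y δ ∈ C :=
    fun x y hxy hx hy h => ⟨shift_mem hpT hxy hx hy hδ0.le h, shift_mem_ball hδ0.le hδρ⟩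
  have hshift_ne : ∀ x y : V, x ≠ y → shift p x y δ ≠ p := fun x y hxy h => by
    have := congrFun h x
    rw [shift_source hxy] at this
    linarith
  -- The hyperplane `x a = p a` through the interior point `p` cuts the punctured neighbourhood into
  -- two star-shaped halves. Their logarithms glue once the punctured slice between them is shown to
  -- be connected.
  let A : Set (V → ℝ) := {x | p a ≤ x a}
  let B : Set (V → ℝ) := {x | x a ≤ p a}
  have hA : IsClosed A := isClosed_le continuous_const (continuous_apply a)
  have hB : IsClosed B := isClosed_le (continuous_apply a) continuous_const
  have hA' : Convex ℝ A := convex_halfSpace_ge (LinearMap.proj a : (V → ℝ) →ₗ[ℝ] ℝ).isLinear _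
  have hB' : Convex ℝ B := convex_halfSpace_le (LinearMap.proj a : (V → ℝ) →ₗ[ℝ] ℝ).isLinear _
  have hswap : ∀ S : Set (V → ℝ), (C \ {p}) ∩ S = (C ∩ S) \ {p} := fun S => by
    ext x; simp only [mem_inter_iff, mem_sdiff]; tauto
  refine HasLogOn.glue hA hB (fun x _ => le_total (p a) (x a)) ?_ ?_ ?_
  · have hq : shift p b a δ ∈ C ∩ A :=
      ⟨hshift b a hab.symm hb ha hδb, by
        show p a ≤ shift p b a δ a; rw [shift_target hab.symm]; linarith⟩
    refine HasLogOn.of_starConvex (q := shift p b a δ) (S := (C \ {p}) ∩ A) ⟨⟨hq.1, hshift_ne b a hab.symm⟩, hq.2⟩ ?_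
      (hfc.mono inter_subset_left) fun x hx => hfn x hx.1
    rw [hswap]
    refine starConvex_diff_singleton (hCc.inter hA') (LinearMap.proj a) hq ?_ fun x hx => hx.2
    simp [shift_target hab.symm, hδ0]
  · have hq : shift p a b δ ∈ C ∩ B :=
      ⟨hshift a b hab ha hb hδa, by
        show shift p a b δ a ≤ p a; rw [shift_source hab]; linarith⟩
    refine HasLogOn.of_starConvex (q := shift p a b δ) (S := (C \ {p}) ∩ B) ⟨⟨hq.1, hshift_ne a b hab⟩, hq.2⟩ ?_
      (hfc.mono inter_subset_left) fun x hx => hfn x hx.1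
    rw [hswap]
    refine starConvex_diff_singleton (hCc.inter hB') (-LinearMap.proj a) hq ?_ fun x hx => ?_
    · simp [shift_source hab, hδ0]
    · simpa using (show x a ≤ p a from hx.2)
  · rw [hswap]
    have hD : Convex ℝ (C ∩ (A ∩ B)) := hCc.inter (hA'.inter hB')
    have hmemD : ∀ x y : V, x ≠ y → x ≠ a → y ≠ a → x ∈ T → y ∈ T → δ ≤ p x →
        shift p x y δ ∈ C ∩ (A ∩ B) := fun x y hxy hxa hya hx hy h => by
      refine ⟨hshift x y hxy hx hy h, ?_, ?_⟩
      · show p a ≤ shift p x y δ a; rw [shift_other hxa.symm hya.symm]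
      · show shift p x y δ a ≤ p a; rw [shift_other hxa.symm hya.symm]
    -- The slice is cut again by `x b = p b`. Both punctured halves are star-shaped, and the fourth
    -- vertex `d` provides the common point `shift p c d δ` with the `a`- and `b`-coordinates of
    -- `p`.
    let P : Set (V → ℝ) := {x | p b ≤ x b}
    let N : Set (V → ℝ) := {x | x b ≤ p b}
    have hP' : Convex ℝ P := convex_halfSpace_ge (LinearMap.proj b : (V → ℝ) →ₗ[ℝ] ℝ).isLinear _
    have hN' : Convex ℝ N := convex_halfSpace_le (LinearMap.proj b : (V → ℝ) →ₗ[ℝ] ℝ).isLinear _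
    have hunion : (C ∩ (A ∩ B)) \ {p} =
        ((C ∩ (A ∩ B)) ∩ P) \ {p} ∪ ((C ∩ (A ∩ B)) ∩ N) \ {p} := by
      rw [← union_sdiff_distrib, ← inter_union_distrib_left]
      congr 1
      exact (inter_eq_left.2 fun x _ => le_total (p b) (x b)).symm
    rw [hunion]
    have hz := hmemD c d (Ne.symm hdc) (Ne.symm hac) hda hc hd hδc
    have hzp := hshift_ne c d (Ne.symm hdc)
    have hzb : shift p c d δ b = p b := shift_other hbc (Ne.symm hdb) δ
    refine IsPreconnected.union (shift p c d δ) ⟨⟨hz, hzb.ge⟩, hzp⟩ ⟨⟨hz, hzb.le⟩, hzp⟩ ?_ ?_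
    · have hq := hmemD c b hbc.symm hac.symm hab.symm hc hb hδc
      have hqb : shift p c b δ b = p b + δ := shift_target hbc.symm δ
      have hqP : shift p c b δ ∈ (C ∩ (A ∩ B)) ∩ P :=
        ⟨hq, by show p b ≤ shift p c b δ b; linarith⟩
      refine (StarConvex.isPathConnected (s := ((C ∩ (A ∩ B)) ∩ P) \ {p}) (a := shift p c b δ) ?_
        ⟨hqP, hshift_ne c b hbc.symm⟩).isConnected.isPreconnected
      refine starConvex_diff_singleton (hD.inter hP') (LinearMap.proj b) hqP ?_ fun x hx => hx.2
      simp [hqb, hδ0]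
    · have hq := hmemD b c hbc hab.symm hac.symm hb hc hδb
      have hqb : shift p b c δ b = p b - δ := shift_source hbc δ
      have hqP : shift p b c δ ∈ (C ∩ (A ∩ B)) ∩ N :=
        ⟨hq, by show shift p b c δ b ≤ p b; linarith⟩
      refine (StarConvex.isPathConnected (s := ((C ∩ (A ∩ B)) ∩ N) \ {p}) (a := shift p b c δ) ?_
        ⟨hqP, hshift_ne b c hbc⟩).isConnected.isPreconnected
      refine starConvex_diff_singleton (hD.inter hN') (-LinearMap.proj b) hqP ?_ fun x hx => ?_
      · simp [hqb, hδ0]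
      · simpa using (show x b ≤ p b from hx.2)

theorem card_le_three (hΓ : Triangulates Γ RealProjectivePlane) {s : Finset V}
    (hs : s ∈ Γ.faces) : s.card ≤ 3 := by
  obtain ⟨T, hsT, hT⟩ := (Set.toFinite Γ.faces).exists_le_maximal hs
  exact (Finset.card_le_card hsT).trans
    (card_le_three_of_maximal hΓ hT.1 fun t ht h => hT.2 ht h)

/-- Two closed sets covering a triangulated projective plane, with finite intersection. -/
theorem subset_of_closed_cover (hΓ : Triangulates Γ RealProjectivePlane) {A B P : Set (V → ℝ)}
    (hA : IsClosed A) (hB : IsClosed B) (hP : P.Finite) (hAB : realizationSet Γ ⊆ A ∪ B)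
    (hint : realizationSet Γ ∩ (A ∩ B) ⊆ P) :
    realizationSet Γ ∩ A ⊆ P ∨ realizationSet Γ ∩ B ⊆ P := by
  obtain ⟨e⟩ := hΓ
  have hfin : (e '' (Subtype.val ⁻¹' P)).Finite :=
    (hP.preimage Subtype.val_injective.injOn).image _
  have hconn : IsPreconnected (realizationSet Γ \ P) := by
    have := (isPreconnected_compl_finite_plane hfin).image (Subtype.val ∘ e.symm)
      (continuous_subtype_val.comp e.symm.continuous).continuousOn
    convert this using 1
    ext x
    constructor
    · rintro ⟨hx, hxP⟩
      refine ⟨e ⟨x, hx⟩, ?_, by simp⟩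
      rintro ⟨y, hy, hyx⟩
      rw [e.injective hyx] at hy
      exact hxP hy
    · rintro ⟨y, hy, rfl⟩
      exact ⟨(e.symm y).2, fun hP => hy ⟨e.symm y, hP, by simp⟩⟩
  by_contra! h
  obtain ⟨⟨x, hx, hxP⟩, ⟨y, hy, hyP⟩⟩ := h.imp not_subset.1 not_subset.1
  -- The realization without the finite set `P` is connected, so two closed sets that both reach
  -- outside `P` must also meet outside `P`.
  obtain ⟨z, ⟨hz, hzP⟩, hzAB⟩ := isPreconnected_closed_iff.1 hconn A B hA hB
    (sdiff_subset.trans hAB) ⟨x, ⟨hx.1, hxP⟩, hx.2⟩ ⟨y, ⟨hy.1, hyP⟩, hy.2⟩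
  exact hzP (hint ⟨hz, hzAB⟩)

/-- The union of a family of closed faces. -/
def faceUnion (S : Set (Finset V)) : Set (V → ℝ) := ⋃ s ∈ S, closedFace s

theorem isClosed_faceUnion (S : Set (Finset V)) : IsClosed (faceUnion S) :=
  (Set.toFinite S).isClosed_biUnion fun s _ => isClosed_closedFace s

theorem mem_faceUnion {S : Set (Finset V)} {x : V → ℝ} :
    x ∈ faceUnion S ↔ ∃ s ∈ S, x ∈ closedFace s := by simp [faceUnion]

theorem eq_single_of_mem_closedFace {x : V → ℝ} {v : V} (hx : x ∈ closedFace {v}) :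
    x = Pi.single v 1 := by
  have h : ∀ w, w ≠ v → x w = 0 := fun w hw => hx.2 w (by simpa using hw)
  have hv : x v = 1 := by
    rw [← hx.1.2, Finset.sum_eq_single v (fun w _ hw => h w hw) (by simp)]
  ext w
  by_cases hw : w = v
  · subst hw; simp [hv]
  · simp [hw, h w hw]

theorem single_mem_closedFace {s : Finset V} {v : V} (hv : v ∈ s) :
    (Pi.single v 1 : V → ℝ) ∈ closedFace s :=
  ⟨single_mem_stdSimplex ℝ v, fun w hw => by
    rw [Pi.single_eq_of_ne]; rintro rfl; exact hw hv⟩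

theorem not_subsingleton_realization (hΓ : Triangulates Γ RealProjectivePlane) (x : V → ℝ) :
    ¬ realizationSet Γ ⊆ {x} := by
  intro h
  obtain ⟨e⟩ := hΓ
  have hsub : ∀ p q : RealProjectivePlane, p = q := fun p q => e.symm.injective (Subtype.ext
    ((h (e.symm p).2).trans (h (e.symm q).2).symm))
  obtain ⟨f, hf, -, -⟩ := exists_chart_plane (proj (Classical.arbitrary _)) Filter.univ_mem
  exact zero_ne_one (hf.injective (hsub (f 0) (f 1)))

/-- A maximal vertex would be an isolated point of a connected space with more than one point. -/
theorem two_le_card_of_maximal (hΓ : Triangulates Γ RealProjectivePlane) {T : Finset V}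
    (hT : T ∈ Γ.faces) (hmax : ∀ s ∈ Γ.faces, T ⊆ s → s ⊆ T) : 2 ≤ T.card := by
  by_contra hcard
  have h1 : T.card = 1 := by
    have := (nonempty_of_mem_faces hT).card_pos
    omega
  obtain ⟨v, rfl⟩ := Finset.card_eq_one.1 h1
  refine (subset_of_closed_cover hΓ (isClosed_closedFace {v})
    (isClosed_faceUnion {s ∈ Γ.faces | v ∉ s}) finite_empty ?_ ?_).elim (fun h => ?_) (fun h => ?_)
  rotate_left 2
  · exact h ⟨mem_realizationSet.2 ⟨_, hT, single_mem_closedFace (by simp)⟩,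
      single_mem_closedFace (Finset.mem_singleton_self v)⟩
  · refine not_subsingleton_realization hΓ (Pi.single v 1) fun x hx => ?_
    by_cases hxv : x ∈ closedFace {v}
    · exact eq_single_of_mem_closedFace hxv
    · obtain ⟨s, hs, hxs⟩ := mem_realizationSet.1 hx
      refine (h ⟨hx, mem_faceUnion.2 ⟨s, ⟨hs, fun hv => hxv ?_⟩, hxs⟩⟩).elim
      exact closedFace_mono (hmax s hs (by simpa using hv)) hxs
  · intro x hx
    obtain ⟨s, hs, hxs⟩ := mem_realizationSet.1 hx
    by_cases hv : v ∈ s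
    · exact Or.inl (closedFace_mono (hmax s hs (by simpa using hv)) hxs)
    · exact Or.inr (mem_faceUnion.2 ⟨s, ⟨hs, hv⟩, hxs⟩)
  · rintro x ⟨-, hx, hx'⟩
    obtain ⟨s, ⟨-, hv⟩, hxs⟩ := mem_faceUnion.1 hx'
    have := hxs.2 v hv
    rw [eq_single_of_mem_closedFace hx] at this
    simp at this

/-- The half of a maximal edge next to `a` meets the rest of the realization at most in the vertex
`a` and the midpoint `m`, so removing these two points would disconnect the plane. -/
theorem three_le_card_of_maximal (hΓ : Triangulates Γ RealProjectivePlane) {T : Finset V}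
    (hT : T ∈ Γ.faces) (hmax : ∀ s ∈ Γ.faces, T ⊆ s → s ⊆ T) : 3 ≤ T.card := by
  by_contra hcard
  have h2 : T.card = 2 := by
    have := two_le_card_of_maximal hΓ hT hmax
    omega
  obtain ⟨a, b, hab, rfl⟩ := Finset.card_eq_two.1 h2
  have hcoord : ∀ x ∈ closedFace {a, b}, x a + x b = 1 := fun x hx => by
    rw [← hx.1.2, ← Finset.sum_subset (Finset.subset_univ {a, b}) fun v _ hv => hx.2 v hv,
      Finset.sum_pair hab]
  have hext : ∀ x ∈ closedFace {a, b}, ∀ y ∈ closedFace {a, b}, x a = y a → x = y := by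
    intro x hx y hy h
    have h1 := hcoord x hx
    have h2 := hcoord y hy
    ext v
    by_cases hv : v ∈ ({a, b} : Finset V)
    · simp only [Finset.mem_insert, Finset.mem_singleton] at hv
      rcases hv with rfl | rfl <;> linarith
    · rw [hx.2 v hv, hy.2 v hv]
  have hea := single_mem_closedFace (show a ∈ ({a, b} : Finset V) by simp)
  have heb := single_mem_closedFace (show b ∈ ({a, b} : Finset V) by simp)
  have hshift : ∀ δ : ℝ, 0 ≤ δ → δ ≤ 1 → shift (Pi.single a 1) a b δ ∈ closedFace {a, b} :=
    fun δ h0 h1 => shift_mem hea hab (by simp) (by simp) h0 (by simpa)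
  have hshifta : ∀ δ : ℝ, shift (Pi.single a 1) a b δ a = 1 - δ := fun δ => by
    rw [shift_source hab]; simp
  set m : V → ℝ := shift (Pi.single a 1) a b (1 / 2) with hm
  have hmT : m ∈ closedFace {a, b} := hshift _ (by norm_num) (by norm_num)
  have hma : m a = 1 / 2 := by rw [hm, hshifta]; norm_num
  have hreal : closedFace {a, b} ⊆ realizationSet Γ := fun x hx => mem_realizationSet.2 ⟨_, hT, hx⟩
  have hA : IsClosed (closedFace {a, b} ∩ {x : V → ℝ | 1 / 2 ≤ x a}) :=
    (isClosed_closedFace _).inter (isClosed_le continuous_const (continuous_apply a))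
  have hB : IsClosed (faceUnion {s ∈ Γ.faces | ¬ {a, b} ⊆ s} ∪
      (closedFace {a, b} ∩ {x : V → ℝ | x a ≤ 1 / 2})) :=
    (isClosed_faceUnion _).union
      ((isClosed_closedFace _).inter (isClosed_le (continuous_apply a) continuous_const))
  refine (subset_of_closed_cover hΓ hA hB (Set.toFinite {Pi.single a 1, m}) ?_ ?_).elim (fun h => ?_) (fun h => ?_)
  rotate_left 2
  · have hq := hshift (1 / 4) (by norm_num) (by norm_num)
    have := h ⟨hreal hq, hq, by
      show (1 : ℝ) / 2 ≤ shift (Pi.single a 1) a b (1 / 4) a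
      rw [hshifta]; norm_num⟩
    rcases this with h | h
    · have := congrFun h a
      rw [hshifta] at this; norm_num at this
    · have := congrFun (show _ = m from h) a
      rw [hshifta, hma] at this; norm_num at this
  · have := h ⟨hreal heb, Or.inr ⟨heb, by simp [hab]⟩⟩
    rcases this with h | h
    · have := congrFun h a
      simp [hab] at this
    · have := congrFun (show _ = m from h) a
      rw [hma] at this; simp [hab] at this
  · intro x hx
    obtain ⟨s, hs, hxs⟩ := mem_realizationSet.1 hx
    by_cases hv : {a, b} ⊆ s
    · have hxT := closedFace_mono (hmax s hs hv) hxs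
      rcases le_total (1 / 2) (x a) with h | h
      · exact Or.inl ⟨hxT, h⟩
      · exact Or.inr (Or.inr ⟨hxT, h⟩)
    · exact Or.inr (Or.inl (mem_faceUnion.2 ⟨s, ⟨hs, hv⟩, hxs⟩))
  · rintro x ⟨-, ⟨hxT, hxa⟩, hx' | ⟨-, hxa'⟩⟩
    · left
      obtain ⟨s, ⟨-, hv⟩, hxs⟩ := mem_faceUnion.1 hx'
      have ha : a ∈ s := by
        by_contra ha
        have := hxs.2 a ha
        have hxa' : 1 / 2 ≤ x a := hxa
        linarith
      have hb : b ∉ s := fun hb => hv (by simp [Finset.insert_subset_iff, ha, hb])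
      refine hext x hxT _ hea ?_
      have := hcoord x hxT
      rw [hxs.2 b hb] at this
      simpa using this
    · right
      refine hext x hxT m hmT ?_
      rw [hma]
      exact le_antisymm hxa' hxa

/-- Every face of a triangulated projective plane is contained in a triangle. -/
theorem exists_triangle_supset (hΓ : Triangulates Γ RealProjectivePlane) {s : Finset V}
    (hs : s ∈ Γ.faces) : ∃ T ∈ Γ.faces, s ⊆ T ∧ T.card = 3 := by
  obtain ⟨T, hsT, hT⟩ := (Set.toFinite Γ.faces).exists_le_maximal hs
  have hmax : ∀ t ∈ Γ.faces, T ⊆ t → t ⊆ T := fun t ht h => hT.2 ht h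
  exact ⟨T, hT.1, hsT, le_antisymm (card_le_three_of_maximal hΓ hT.1 hmax)
    (three_le_card_of_maximal hΓ hT.1 hmax)⟩

/-- A set of triangles closed under passing to a triangle with a common edge is empty or contains
all triangles. -/
theorem triangle_induction (hΓ : Triangulates Γ RealProjectivePlane) {p : Finset V → Prop}
    {T₀ : Finset V} (hT₀ : T₀ ∈ Γ.faces) (hc₀ : T₀.card = 3) (h₀ : p T₀)
    (h : ∀ T ∈ Γ.faces, ∀ T' ∈ Γ.faces, T.card = 3 → T'.card = 3 → 2 ≤ (T ∩ T').card → p T → p T')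
    {T : Finset V} (hT : T ∈ Γ.faces) (hc : T.card = 3) : p T := by
  by_contra hpT
  have hbary : ∀ s : Finset V, s.card = 3 → barycenter s ∉ range fun v : V => (Pi.single v 1 : V → ℝ) := by
    rintro s hs ⟨v, hv⟩
    have hne : s.Nonempty := Finset.card_pos.1 (by omega)
    have h1 := carrier_barycenter hne
    have h2 : carrier (barycenter s) ⊆ {v} := by
      rw [carrier_subset_iff (barycenter_mem hne).1, ← show Pi.single v 1 = barycenter s from hv]
      exact single_mem_closedFace (by simp)
    rw [h1] at h2
    have := Finset.card_le_card h2
    rw [hs] at this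
    simp at this
  -- If `p` held for `T₀` and failed for `T`, the triangles with `p` and those without it would meet
  -- only in vertices, yet each family contains a barycentre, which is not a vertex.
  refine (subset_of_closed_cover hΓ (isClosed_faceUnion {s ∈ Γ.faces | s.card = 3 ∧ p s})
    (isClosed_faceUnion {s ∈ Γ.faces | s.card = 3 ∧ ¬ p s})
    (finite_range fun v : V => (Pi.single v 1 : V → ℝ)) ?_ ?_).elim (fun h' => ?_) (fun h' => ?_)
  rotate_left 2
  · have hb := barycenter_mem (s := T₀) (Finset.card_pos.1 (by omega))
    exact hbary T₀ hc₀ (h' ⟨mem_realizationSet.2 ⟨T₀, hT₀, hb⟩,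
      mem_faceUnion.2 ⟨T₀, ⟨hT₀, hc₀, h₀⟩, hb⟩⟩)
  · have hb := barycenter_mem (s := T) (Finset.card_pos.1 (by omega))
    exact hbary T hc (h' ⟨mem_realizationSet.2 ⟨T, hT, hb⟩,
      mem_faceUnion.2 ⟨T, ⟨hT, hc, hpT⟩, hb⟩⟩)
  · intro x hx
    obtain ⟨s, hs, hxs⟩ := mem_realizationSet.1 hx
    obtain ⟨t, ht, hst, htc⟩ := exists_triangle_supset hΓ hs
    by_cases hpt : p t
    · exact Or.inl (mem_faceUnion.2 ⟨t, ⟨ht, htc, hpt⟩, closedFace_mono hst hxs⟩)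
    · exact Or.inr (mem_faceUnion.2 ⟨t, ⟨ht, htc, hpt⟩, closedFace_mono hst hxs⟩)
  · rintro x ⟨-, hx, hx'⟩
    obtain ⟨s, ⟨hs, hsc, hps⟩, hxs⟩ := mem_faceUnion.1 hx
    obtain ⟨t, ⟨ht, htc, hpt⟩, hxt⟩ := mem_faceUnion.1 hx'
    have hsub : carrier x ⊆ s ∩ t := Finset.subset_inter ((carrier_subset_iff hxs.1).2 hxs)
      ((carrier_subset_iff hxs.1).2 hxt)
    have hlt : (carrier x).card < 2 := by
      by_contra hge
      exact hpt (h s hs t ht hsc htc (by have := Finset.card_le_card hsub; omega) hps)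
    have h1 : (carrier x).card = 1 := by
      have := (carrier_nonempty hxs.1).card_pos
      omega
    obtain ⟨v, hv⟩ := Finset.card_eq_one.1 h1
    exact ⟨v, (eq_single_of_mem_closedFace ((carrier_subset_iff hxs.1).1 hv.subset)).symm⟩

end Local

/-! ### Mapping degrees around an edge: exactly two triangles contain it. -/

section Pages

variable {V : Type*} [Fintype V] [DecidableEq V] {Γ : PreAbstractSimplicialComplex V}

/-- The fold of the triangles around the edge `{a, b}` onto the plane: the triangle with third
vertex `c` goes to the upper half plane and all others to the lower half plane. -/
noncomputable def pageMap (a b c : V) (x : V → ℝ) : ℂ :=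
  -- The quantity `1 - x a - x b` is the mass off the edge. The imaginary part is therefore `x c` on
  -- the triangle with third vertex `c`, and minus the third coordinate on any other triangle over
  -- the edge.
  ⟨x a - x b, 2 * x c - (1 - x a - x b)⟩

theorem continuous_pageMap (a b c : V) : Continuous (pageMap a b c) := by
  have : pageMap a b c = fun x => ((x a - x b : ℝ) : ℂ) +
      ((2 * x c - (1 - x a - x b) : ℝ) : ℂ) * Complex.I := by
    ext x
    rw [← Complex.mk_eq_add_mul_I]
    rfl
  rw [this]
  fun_prop

theorem barycenter_pair {a b : V} (hab : a ≠ b) :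
    barycenter {a, b} a = 1 / 2 ∧ barycenter {a, b} b = 1 / 2 := by
  simp [barycenter, Finset.card_pair hab]

/-- If `x c` were nonzero, the carrier would be `{a, b, c}` and the imaginary part would be `x c`.
Hence `x c = 0`, there is no mass off the edge, and the real part gives `x a = x b`. -/
theorem eq_barycenter_of_pageMap_eq_zero (hΓ : Triangulates Γ RealProjectivePlane) {a b c : V}
    (hab : a ≠ b) (hca : c ≠ a) (hcb : c ≠ b) {x : V → ℝ} (hx : x ∈ realizationSet Γ)
    (ha : x a ≠ 0) (hb : x b ≠ 0) (h : pageMap a b c x = 0) : x = barycenter {a, b} := by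
  have hre : x a - x b = 0 := congrArg Complex.re h
  have him : 2 * x c - (1 - x a - x b) = 0 := congrArg Complex.im h
  have hcard := card_le_three hΓ (carrier_mem_faces hx)
  have hnn := hx.1.1
  have hc : x c = 0 := by
    by_contra hc
    have hsub : ({a, b, c} : Finset V) ⊆ carrier x := by
      simp [Finset.insert_subset_iff, mem_carrier, ha, hb, hc]
    have heq := Finset.eq_of_subset_of_card_le hsub (hcard.trans_eq
      (Finset.card_eq_three.2 ⟨a, b, c, hab, hca.symm, hcb.symm, rfl⟩).symm)
    have hmem := (carrier_subset_iff hx.1).1 heq.ge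
    have hsum := hx.1.2
    rw [← Finset.sum_subset (Finset.subset_univ {a, b, c}) fun v _ hv => hmem.2 v hv,
      Finset.sum_insert (by simp [hab, hca.symm]), Finset.sum_pair hcb.symm] at hsum
    exact hc (by linarith)
  obtain ⟨pa, pb⟩ := barycenter_pair hab
  ext v
  by_cases hva : v = a
  · subst hva; linarith
  by_cases hvb : v = b
  · subst hvb; linarith
  have hsum : ∑ w ∈ {a, b, v}, x w ≤ 1 := by
    rw [← hx.1.2]
    exact Finset.sum_le_sum_of_subset_of_nonneg (Finset.subset_univ _) fun w _ _ => hnn w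
  rw [Finset.sum_insert (by simp [hab, Ne.symm hva]), Finset.sum_pair (Ne.symm hvb)] at hsum
  have := hnn v
  have hv : x v = 0 := by linarith
  simp [hv, barycenter, hva, hvb]

/-- A loop around the barycentre of the edge `{a, b}`, through the triangles with third vertices `c`
and `d`. -/
noncomputable def pageLoop (a b c d : V) (ε : ℝ) (t : ℝ) : V → ℝ :=
  Pi.single a ((1 - ε * |Real.sin (2 * Real.pi * t)| + ε * Real.cos (2 * Real.pi * t)) / 2) +
  Pi.single b ((1 - ε * |Real.sin (2 * Real.pi * t)| - ε * Real.cos (2 * Real.pi * t)) / 2) +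
  Pi.single c (ε * (|Real.sin (2 * Real.pi * t)| + Real.sin (2 * Real.pi * t)) / 2) +
  Pi.single d (ε * (|Real.sin (2 * Real.pi * t)| - Real.sin (2 * Real.pi * t)) / 2)

theorem continuous_pageLoop (a b c d : V) (ε : ℝ) : Continuous (pageLoop a b c d ε) := by
  refine continuous_pi fun v => ?_
  simp only [pageLoop, Pi.add_apply, Pi.single_apply]
  split_ifs <;> fun_prop

theorem pageLoop_add_one (a b c d : V) (ε t : ℝ) :
    pageLoop a b c d ε (t + 1) = pageLoop a b c d ε t := by
  simp [pageLoop, mul_add]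

section Loop

variable {a b c d : V} (hab : a ≠ b) (hca : c ≠ a) (hcb : c ≠ b) (hda : d ≠ a) (hdb : d ≠ b)
  (hcd : c ≠ d)
include hab hca hcb hda hdb hcd

theorem pageLoop_apply (ε t : ℝ) :
    pageLoop a b c d ε t a =
      (1 - ε * |Real.sin (2 * Real.pi * t)| + ε * Real.cos (2 * Real.pi * t)) / 2 ∧
    pageLoop a b c d ε t b =
      (1 - ε * |Real.sin (2 * Real.pi * t)| - ε * Real.cos (2 * Real.pi * t)) / 2 ∧
    pageLoop a b c d ε t c =
      ε * (|Real.sin (2 * Real.pi * t)| + Real.sin (2 * Real.pi * t)) / 2 ∧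
    pageLoop a b c d ε t d =
      ε * (|Real.sin (2 * Real.pi * t)| - Real.sin (2 * Real.pi * t)) / 2 ∧
    ∀ v, v ≠ a → v ≠ b → v ≠ c → v ≠ d → pageLoop a b c d ε t v = 0 := by
  refine ⟨?_, ?_, ?_, ?_, fun v h1 h2 h3 h4 => ?_⟩ <;>
    simp [pageLoop, *, Ne.symm hab, Ne.symm hca, Ne.symm hcb, Ne.symm hda,
      Ne.symm hdb, Ne.symm hcd]

theorem pageLoop_mem {ε : ℝ} (h0 : 0 ≤ ε) (h1 : ε ≤ 1 / 2) (hc : {a, b, c} ∈ Γ.faces)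
    (hd : {a, b, d} ∈ Γ.faces) (t : ℝ) : pageLoop a b c d ε t ∈ realizationSet Γ := by
  obtain ⟨ea, eb, ec, ed, ev⟩ := pageLoop_apply hab hca hcb hda hdb hcd ε t
  have hs := Real.abs_sin_le_one (2 * Real.pi * t)
  have hk := abs_le.1 (Real.abs_cos_le_one (2 * Real.pi * t))
  have hs0 := neg_abs_le (Real.sin (2 * Real.pi * t))
  have hs1 := le_abs_self (Real.sin (2 * Real.pi * t))
  have hstd : pageLoop a b c d ε t ∈ stdSimplex ℝ V := by
    refine ⟨fun v => ?_, ?_⟩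
    · by_cases hva : v = a
      · subst hva; rw [ea]; nlinarith
      by_cases hvb : v = b
      · subst hvb; rw [eb]; nlinarith
      by_cases hvc : v = c
      · subst hvc; rw [ec]; nlinarith
      by_cases hvd : v = d
      · subst hvd; rw [ed]; nlinarith
      rw [ev v hva hvb hvc hvd]
    · simp only [pageLoop, Pi.add_apply, Finset.sum_add_distrib, Pi.single_apply,
        Finset.sum_ite_eq', Finset.mem_univ, if_true]
      ring
  rcases le_total 0 (Real.sin (2 * Real.pi * t)) with hsin | hsin
  · refine ⟨hstd, _, hc, fun v hv => ?_⟩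
    simp only [Finset.mem_insert, Finset.mem_singleton, not_or] at hv
    by_cases hvd : v = d
    · subst hvd; rw [ed, abs_of_nonneg hsin]; ring
    · exact ev v hv.1 hv.2.1 hv.2.2 hvd
  · refine ⟨hstd, _, hd, fun v hv => ?_⟩
    simp only [Finset.mem_insert, Finset.mem_singleton, not_or] at hv
    by_cases hvc : v = c
    · subst hvc; rw [ec, abs_of_nonpos hsin]; ring
    · exact ev v hv.1 hv.2.1 hvc hv.2.2

theorem pageLoop_mem_ball {ε r : ℝ} (h0 : 0 ≤ ε) (hr : ε < r) (t : ℝ) :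
    pageLoop a b c d ε t ∈ Metric.ball (barycenter {a, b}) r := by
  obtain ⟨ea, eb, ec, ed, ev⟩ := pageLoop_apply hab hca hcb hda hdb hcd ε t
  obtain ⟨pa, pb⟩ := barycenter_pair hab
  have hs := Real.abs_sin_le_one (2 * Real.pi * t)
  have hk := abs_le.1 (Real.abs_cos_le_one (2 * Real.pi * t))
  have hs0 := neg_abs_le (Real.sin (2 * Real.pi * t))
  have hs1 := le_abs_self (Real.sin (2 * Real.pi * t))
  have hs2 := abs_nonneg (Real.sin (2 * Real.pi * t))
  have hout : ∀ v, v ≠ a → v ≠ b → barycenter {a, b} v = 0 := fun v h1 h2 => by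
    simp [barycenter, h1, h2]
  rw [Metric.mem_ball, dist_pi_lt_iff (h0.trans_lt hr)]
  intro v
  refine lt_of_le_of_lt ?_ hr
  rw [Real.dist_eq, abs_le]
  by_cases hva : v = a
  · subst hva; rw [ea, pa]; constructor <;> nlinarith
  by_cases hvb : v = b
  · subst hvb; rw [eb, pb]; constructor <;> nlinarith
  rw [hout v hva hvb]
  by_cases hvc : v = c
  · subst hvc; rw [ec]; constructor <;> nlinarith
  by_cases hvd : v = d
  · subst hvd; rw [ed]; constructor <;> nlinarith
  rw [ev v hva hvb hvc hvd]
  constructor <;> linarith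

theorem pageMap_pageLoop_left {ε : ℝ} (t : ℝ) : pageMap a b c (pageLoop a b c d ε t) =
    ε * Complex.exp (2 * Real.pi * t * Complex.I) := by
  obtain ⟨ea, eb, ec, ed, ev⟩ := pageLoop_apply hab hca hcb hda hdb hcd ε t
  have : (2 * Real.pi * t * Complex.I : ℂ) = ((2 * Real.pi * t : ℝ) : ℂ) * Complex.I := by
    push_cast; ring
  rw [this, pageMap, ea, eb, ec]
  apply Complex.ext
  · rw [Complex.re_ofReal_mul, Complex.exp_ofReal_mul_I_re]; ring
  · rw [Complex.im_ofReal_mul, Complex.exp_ofReal_mul_I_im]; ring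

/-- For a third page `e`, both pages of the loop fold into the lower half plane, where a logarithm
exists; hence the winding number is zero. -/
theorem pageMap_pageLoop_other {e : V} (hea : e ≠ a) (heb : e ≠ b) (hec : e ≠ c) (hed : e ≠ d)
    {ε : ℝ} (t : ℝ) : pageMap a b e (pageLoop a b c d ε t) =
      ⟨ε * Real.cos (2 * Real.pi * t), -(ε * |Real.sin (2 * Real.pi * t)|)⟩ := by
  obtain ⟨ea, eb, ec, ed, ev⟩ := pageLoop_apply hab hca hcb hda hdb hcd ε t
  rw [pageMap, ea, eb, ev e hea heb hec hed]
  apply Complex.ext <;> simp <;> ring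

end Loop

/-- The closed lower half plane without the origin carries a logarithm. -/
theorem hasLogOn_lowerHalfPlane : HasLogOn (fun z : ℂ => z) ({z | z.im ≤ 0} \ {0}) := by
  have hC : Convex ℝ {z : ℂ | z.im ≤ 0} := convex_halfSpace_le Complex.imLm.isLinear 0
  refine HasLogOn.of_starConvex (S := {z | z.im ≤ 0} \ {0}) (q := -Complex.I)
    ⟨by simp, by simp⟩
    (starConvex_diff_singleton hC (-Complex.imLm) (by simp) (by simp) fun x hx => ?_)
    continuousOn_id fun x hx => hx.2
  simpa using hx

/-- In a triangulated projective plane no three triangles share an edge. -/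
theorem no_three_pages (hΓ : Triangulates Γ RealProjectivePlane) {a b c d e : V} (hab : a ≠ b)
    (hca : c ≠ a) (hcb : c ≠ b) (hda : d ≠ a) (hdb : d ≠ b) (hea : e ≠ a) (heb : e ≠ b)
    (hcd : c ≠ d) (hce : c ≠ e) (hde : d ≠ e) (hc : {a, b, c} ∈ Γ.faces)
    (hd : {a, b, d} ∈ Γ.faces) (he : {a, b, e} ∈ Γ.faces) : False := by
  set p : V → ℝ := barycenter {a, b} with hp
  obtain ⟨pa, pb⟩ := barycenter_pair hab
  have hpΓ : p ∈ realizationSet Γ := mem_realizationSet.2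
    ⟨{a, b}, mem_faces_of_subset hc (by simp [Finset.insert_subset_iff]) (by simp),
      barycenter_mem (by simp)⟩
  have hU : {x : V → ℝ | x a ≠ 0 ∧ x b ≠ 0} ∈ 𝓝 p := by
    refine Filter.inter_mem ?_ ?_
    · exact (continuous_apply a).continuousAt.eventually_ne (by rw [hp, pa]; norm_num)
    · exact (continuous_apply b).continuousAt.eventually_ne (by rw [hp, pb]; norm_num)
  obtain ⟨ψ, hψ, hψ0, hψr, r, hr, hball⟩ := exists_chart hΓ hpΓ hU
  have hinv : ∀ z, Function.invFun ψ (ψ z) = z := Function.leftInverse_invFun hψ.injective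
  -- Read in the chart, each fold is a self map of the punctured plane and so has a degree.
  have hdeg : ∀ v, v ≠ a → v ≠ b → ∃ n : ℤ, ∀ u m, IsWinding u m →
      IsWinding ((pageMap a b v ∘ ψ) ∘ u) (m * n) := fun v hva hvb =>
    exists_degree ((continuous_pageMap a b v).comp hψ.continuous).continuousOn fun z hz h => by
      have hmem := hψr ⟨z, rfl⟩
      have := eq_barycenter_of_pageMap_eq_zero hΓ hab hva hvb hmem.1 hmem.2.1 hmem.2.2 h
      exact hz (hψ.injective (this.trans hψ0.symm))
  obtain ⟨n, hn⟩ := hdeg c hca hcb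
  obtain ⟨m, hm⟩ := hdeg d hda hdb
  -- The bound `1 / 2` keeps the coordinates of the loops nonnegative; the bound by `r / 2` keeps
  -- the loops inside the image of the chart.
  set ε := min (1 / 2) (r / 2) with hε
  have hε0 : 0 < ε := lt_min (by norm_num) (half_pos hr)
  have hε1 : ε ≤ 1 / 2 := min_le_left _ _
  have hεr : ε < r := (min_le_right _ _).trans_lt (half_lt_self hr)
  have hloop : ∀ v w : V, v ≠ a → v ≠ b → w ≠ a → w ≠ b → v ≠ w → {a, b, v} ∈ Γ.faces →
      {a, b, w} ∈ Γ.faces → ∃ (k : ℤ) (u : ℝ → ℂ), IsWinding u k ∧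
        ψ ∘ u = pageLoop a b v w ε := by
    intro v w hva hvb hwa hwb hvw hv hw
    have hmem : ∀ t, pageLoop a b v w ε t ∈ range ψ := fun t =>
      hball ⟨pageLoop_mem hab hva hvb hwa hwb hvw hε0.le hε1 hv hw t,
        pageLoop_mem_ball hab hva hvb hwa hwb hvw hε0.le hεr t⟩
    have hψu : ∀ t, ψ (Function.invFun ψ (pageLoop a b v w ε t)) = pageLoop a b v w ε t :=
      fun t => Function.invFun_eq (hmem t)
    obtain ⟨k, hk⟩ := exists_isWinding (u := fun t => Function.invFun ψ (pageLoop a b v w ε t))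
      ((continuousOn_invFun hψ).comp_continuous (continuous_pageLoop a b v w ε) hmem)
      (fun t h => by
        have h1 := hψu t
        rw [h, hψ0] at h1
        have h2 := pageMap_pageLoop_left hab hva hvb hwa hwb hvw (ε := ε) t
        rw [← h1] at h2
        have h3 : pageMap a b v p = 0 := by
          apply Complex.ext
          · simp [pageMap, hp, pa, pb]
          · simp only [pageMap, hp, pa, pb]
            simp [barycenter, hva, hvb]
            norm_num
        rw [h3] at h2
        exact mul_ne_zero (by exact_mod_cast hε0.ne') (Complex.exp_ne_zero _) h2.symm)
      fun t => by simp only [pageLoop_add_one]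
    exact ⟨k, _, hk, funext hψu⟩
  obtain ⟨k, u, hk, hu⟩ := hloop c d hca hcb hda hdb hcd hc hd
  obtain ⟨l, w, hl, hw⟩ := hloop d e hda hdb hea heb hde hd he
  have h1 : IsWinding (pageMap a b c ∘ pageLoop a b c d ε) 1 := by
    convert isWinding_circle hε0 using 2 with t
    exact pageMap_pageLoop_left hab hca hcb hda hdb hcd t
  have h2 : IsWinding (pageMap a b d ∘ pageLoop a b d e ε) 1 := by
    convert isWinding_circle hε0 using 2 with t
    exact pageMap_pageLoop_left hab hda hdb hea heb hde t
  have h3 : IsWinding (pageMap a b c ∘ pageLoop a b d e ε) 0 := by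
    refine hasLogOn_lowerHalfPlane.isWinding (γ := pageMap a b c ∘ pageLoop a b d e ε)
      ((continuous_pageMap a b c).comp (continuous_pageLoop a b d e ε)) (fun t => ?_)
      fun t => by simp only [Function.comp, pageLoop_add_one]
    simp only [Function.comp,
      pageMap_pageLoop_other hab hda hdb hea heb hde hca hcb hcd hce]
    refine ⟨by simpa using mul_nonneg hε0.le (abs_nonneg _), fun h => ?_⟩
    have hre : ε * Real.cos (2 * Real.pi * t) = 0 := congrArg Complex.re h
    have him : -(ε * |Real.sin (2 * Real.pi * t)|) = 0 := congrArg Complex.im h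
    have hcos := (mul_eq_zero.1 hre).resolve_left hε0.ne'
    have hsin := (mul_eq_zero.1 (neg_eq_zero.1 him)).resolve_left hε0.ne'
    have := Real.sin_sq_add_cos_sq (2 * Real.pi * t)
    rw [hcos, abs_eq_zero.1 hsin] at this
    norm_num at this
  -- With degrees `n`, `m` of the folds at `c`, `d` and winding numbers `k`, `l` of the loops
  -- through `c, d` and `d, e`, the equations are `k n = 1`, `l m = 1` and `l n = 0`, which is
  -- impossible.
  have e1 := (hn u k hk).unique (by rw [Function.comp_assoc, hu]; exact h1)
  have e2 := (hm w l hl).unique (by rw [Function.comp_assoc, hw]; exact h2)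
  have e3 := (hn w l hl).unique (by rw [Function.comp_assoc, hw]; exact h3)
  rcases mul_eq_zero.1 e3 with h | h
  · rw [h, zero_mul] at e2; exact zero_ne_one e2
  · rw [h, mul_zero] at e1; exact zero_ne_one e1

/-- In a triangulated projective plane every edge lies in exactly two triangles. -/
theorem exists_two_triangles (hΓ : Triangulates Γ RealProjectivePlane) {a b : V} (hab : a ≠ b)
    (he : {a, b} ∈ Γ.faces) : ∃ c d : V, c ≠ d ∧ c ≠ a ∧ c ≠ b ∧ d ≠ a ∧ d ≠ b ∧
      {a, b, c} ∈ Γ.faces ∧ {a, b, d} ∈ Γ.faces ∧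
      ∀ e, e ≠ a → e ≠ b → {a, b, e} ∈ Γ.faces → e = c ∨ e = d := by
  have hthird : ∀ T ∈ Γ.faces, {a, b} ⊆ T → T.card = 3 → ∃ c, c ≠ a ∧ c ≠ b ∧ T = {a, b, c} := by
    intro T hT hsub hcard
    obtain ⟨c, hc⟩ := Finset.card_eq_one.1 (show (T \ {a, b}).card = 1 by
      rw [Finset.card_sdiff_of_subset hsub, hcard, Finset.card_pair hab])
    have hcm : c ∈ T \ {a, b} := by rw [hc]; simp
    simp only [Finset.mem_sdiff, Finset.mem_insert, Finset.mem_singleton, not_or] at hcm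
    refine ⟨c, hcm.2.1, hcm.2.2, ?_⟩
    rw [← Finset.union_sdiff_of_subset hsub, hc]
    ext v; simp
  obtain ⟨T, hT, hsub, hcard⟩ := exists_triangle_supset hΓ he
  obtain ⟨c, hca, hcb, rfl⟩ := hthird T hT hsub hcard
  obtain ⟨d, hcd, hda, hdb, hd⟩ : ∃ d, c ≠ d ∧ d ≠ a ∧ d ≠ b ∧ {a, b, d} ∈ Γ.faces := by
    -- With a single triangle over the edge, every face containing the edge lies in that triangle,
    -- so the barycentre of the edge is a boundary point.
    by_contra! hno
    have hne : ({a, b} : Finset V).Nonempty := by simp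
    refine no_boundary hΓ hT (closedFace_mono hsub (barycenter_mem hne)) ?_
      (c := c) (by simp) (by simp [barycenter, hca, hcb])
    intro s hs hcs
    rw [carrier_barycenter hne] at hcs
    obtain ⟨T', hT', hsT', hcard'⟩ := exists_triangle_supset hΓ hs
    obtain ⟨d, hda, hdb, rfl⟩ := hthird T' hT' (hcs.trans hsT') hcard'
    by_cases hcd : c = d
    · rw [hcd]; exact hsT'
    · exact (hno d hcd hda hdb hT').elim
  refine ⟨c, d, hcd, hca, hcb, hda, hdb, hT, hd, fun e hea heb he => ?_⟩
  by_contra! hno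
  exact no_three_pages hΓ hab hca hcb hda hdb hea heb hcd hno.1.symm hno.2.symm hT hd he

end Pages

/-! ### The mod 2 cocycle of the double covering. -/

/-- The action of `ZMod 2` on the sphere through the antipodal map. -/
noncomputable def flip (k : ZMod 2) (x : Sphere2) : Sphere2 := if k = 0 then x else -x

theorem flip_flip (j k : ZMod 2) (x : Sphere2) : flip j (flip k x) = flip (j + k) x := by
  have h : ∀ k : ZMod 2, k = 0 ∨ k = 1 := by decide
  rcases h j with rfl | rfl <;> rcases h k with rfl | rfl <;>
    simp [flip, show (1 + 1 : ZMod 2) = 0 from rfl]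

theorem continuous_flip (k : ZMod 2) : Continuous (flip k) := by
  unfold flip
  split_ifs
  · exact continuous_id
  · exact continuous_neg

theorem proj_flip (k : ZMod 2) (x : Sphere2) : proj (flip k x) = proj x := by
  unfold flip
  split_ifs
  · rfl
  · exact proj_neg x

theorem flip_injective_left (x : Sphere2) : Function.Injective fun k => flip k x := by
  have h : ∀ k : ZMod 2, k = 0 ∨ k = 1 := by decide
  intro j k hjk
  rcases h j with rfl | rfl <;> rcases h k with rfl | rfl <;> simp [flip] at hjk ⊢
  · exact sphere_ne_neg x hjk
  · exact sphere_ne_neg x hjk.symm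

theorem exists_flip_eq {x y : Sphere2} (h : proj x = proj y) : ∃ k, x = flip k y := by
  rcases proj_eq_proj.1 h with h | h
  · exact ⟨0, by simp [flip, h]⟩
  · exact ⟨1, by simp [flip, h]⟩

section Cocycle

variable {V : Type*} [Fintype V] [DecidableEq V] {Γ : PreAbstractSimplicialComplex V}

theorem exists_lift_closedFace {h : (V → ℝ) → RealProjectivePlane} {F : Finset V}
    (hF : F.Nonempty) (hh : ContinuousOn h (closedFace F)) :
    ∃ L : (V → ℝ) → Sphere2, ContinuousOn L (closedFace F) ∧
      ∀ x ∈ closedFace F, proj (L x) = h x := by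
  classical
  have hq := barycenter_mem hF
  obtain ⟨e, he⟩ := surjective_proj (h (barycenter F))
  obtain ⟨L, hL, -⟩ := exists_lift_of_starConvex isCoveringMap_proj hq
    ((convex_closedFace F).starConvex hq)
    ⟨_, continuousOn_iff_continuous_domRestrict.1 hh⟩ (e := e) he
  refine ⟨fun x => if hx : x ∈ closedFace F then L ⟨x, hx⟩ else Classical.arbitrary _, ?_, ?_⟩
  · rw [continuousOn_iff_continuous_domRestrict]
    convert L.continuous using 1
    ext x
    simp
  · intro x hx
    simp only [hx, dif_pos]
    exact hL ⟨x, hx⟩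

/-- Lifts over a face that agree at a vertex agree. -/
theorem eqOn_of_lift {F : Finset V} {L M : (V → ℝ) → Sphere2} (hL : ContinuousOn L (closedFace F))
    (hM : ContinuousOn M (closedFace F)) (h : ∀ x ∈ closedFace F, proj (L x) = proj (M x)) {a : V}
    (ha : a ∈ F) (hLM : L (Pi.single a 1) = M (Pi.single a 1)) : EqOn L M (closedFace F) :=
  isCoveringMap_proj.eqOn_of_comp_eqOn (convex_closedFace F).isPreconnected hL hM h
    (single_mem_closedFace ha) hLM

/-- The cocycle of the universal covering of a triangulated projective plane: it is not a
coboundary. -/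
theorem exists_cocycle (hΓ : Triangulates Γ RealProjectivePlane) : ∃ z : V → V → ZMod 2,
    (∀ a b, z a b = z b a) ∧
    (∀ F ∈ Γ.faces, ∀ a ∈ F, ∀ b ∈ F, ∀ c ∈ F, z a b + z b c = z a c) ∧
    ∀ φ : V → ZMod 2, ∃ a b, a ≠ b ∧ {a, b} ∈ Γ.faces ∧ z a b ≠ φ a + φ b := by
  classical
  obtain ⟨e⟩ := hΓ
  let h : (V → ℝ) → RealProjectivePlane := fun x =>
    if hx : x ∈ realizationSet Γ then e ⟨x, hx⟩ else proj (Classical.arbitrary _)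
  have hh : ContinuousOn h (realizationSet Γ) := by
    rw [continuousOn_iff_continuous_domRestrict]
    convert e.continuous using 1
    ext x
    simp [h]
  have hsub : ∀ F ∈ Γ.faces, closedFace F ⊆ realizationSet Γ := fun F hF x hx =>
    mem_realizationSet.2 ⟨F, hF, hx⟩
  have hex : ∀ F : Finset V, ∃ L : (V → ℝ) → Sphere2, F ∈ Γ.faces →
      ContinuousOn L (closedFace F) ∧ ∀ x ∈ closedFace F, proj (L x) = h x := fun F => by
    by_cases hF : F ∈ Γ.faces
    · obtain ⟨L, hL⟩ := exists_lift_closedFace (nonempty_of_mem_faces hF) (hh.mono (hsub F hF))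
      exact ⟨L, fun _ => hL⟩
    · exact ⟨fun _ => Classical.arbitrary _, fun hF' => (hF hF').elim⟩
  choose L hL using hex
  choose s hs using fun v : V => surjective_proj (h (Pi.single v 1))
  -- The number `σ F v` compares the lift over `F` with the chosen point `s v` above the vertex; it
  -- is set to `0` where this has no meaning.
  have hexσ : ∀ (F : Finset V) (v : V), ∃ k : ZMod 2, F ∈ Γ.faces → v ∈ F →
      L F (Pi.single v 1) = flip k (s v) := fun F v => by
    by_cases hFv : F ∈ Γ.faces ∧ v ∈ F
    · obtain ⟨k, hk⟩ := exists_flip_eq (((hL F hFv.1).2 _ (single_mem_closedFace hFv.2)).trans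
        (hs v).symm)
      exact ⟨k, fun _ _ => hk⟩
    · exact ⟨0, fun h1 h2 => (hFv ⟨h1, h2⟩).elim⟩
  choose σ hσ using hexσ
  have arith₁ : ∀ i j : ZMod 2, j + i + i = j := by decide
  have arith₂ : ∀ i j k l : ZMod 2, j + i + k = l → i + k = j + l := by decide
  -- Over a common face, two lifts differ by one deck transformation, which cancels in the sum of
  -- two values of `σ`.
  have key : ∀ F ∈ Γ.faces, ∀ G ∈ Γ.faces, ∀ a ∈ F, ∀ b ∈ F, a ∈ G → b ∈ G →
      σ F a + σ F b = σ G a + σ G b := by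
    intro F hF G hG a haF b hbF haG hbG
    have hmem : ∀ v, v ∈ F → v ∈ G → v ∈ F ∩ G := fun v h1 h2 => Finset.mem_inter.2 ⟨h1, h2⟩
    have hcF : closedFace (F ∩ G) ⊆ closedFace F := closedFace_mono Finset.inter_subset_left
    have hcG : closedFace (F ∩ G) ⊆ closedFace G := closedFace_mono Finset.inter_subset_right
    have heq : EqOn (fun x => flip (σ G a + σ F a) (L F x)) (L G) (closedFace (F ∩ G)) := by
      refine eqOn_of_lift ((continuous_flip _).comp_continuousOn ((hL F hF).1.mono hcF))
        ((hL G hG).1.mono hcG) (fun x hx => ?_) (hmem a haF haG) ?_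
      · rw [proj_flip, (hL F hF).2 x (hcF hx), (hL G hG).2 x (hcG hx)]
      · rw [hσ F a hF haF, hσ G a hG haG, flip_flip, arith₁]
    have hb := heq (single_mem_closedFace (hmem b hbF hbG))
    simp only at hb
    rw [hσ F b hF hbF, hσ G b hG hbG, flip_flip] at hb
    exact arith₂ _ _ _ _ (flip_injective_left _ hb)
  refine ⟨fun a b => σ {a, b} a + σ {a, b} b, fun a b => ?_, ?_, ?_⟩
  · show σ {a, b} a + σ {a, b} b = σ {b, a} b + σ {b, a} a
    rw [Finset.pair_comm, add_comm]
  · intro F hF a ha b hb c hc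
    have hz : ∀ a ∈ F, ∀ b ∈ F, σ {a, b} a + σ {a, b} b = σ F a + σ F b := fun a ha b hb =>
      key _ (mem_faces_of_subset hF (by simp [Finset.insert_subset_iff, ha, hb]) (by simp)) F hF
        a (by simp) b (by simp) ha hb
    simp only [hz a ha b hb, hz b hb c hc, hz a ha c hc]
    generalize σ F a = i
    generalize σ F b = j
    generalize σ F c = k
    revert i j k; decide
  · intro φ
    -- If `φ` bounded the cocycle, each lift could be flipped by a constant `κ F` so as to take the
    -- prescribed value `flip (φ a) (s a)` at every vertex. The corrected lifts would agree on
    -- common faces and glue to a section of `proj`.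
    by_contra! hφ
    have hκ : ∀ F ∈ Γ.faces, ∀ a ∈ F, ∀ b ∈ F, σ F a + φ a = σ F b + φ b := by
      intro F hF a ha b hb
      by_cases hab : a = b
      · rw [hab]
      have hpair : {a, b} ∈ Γ.faces :=
        mem_faces_of_subset hF (by simp [Finset.insert_subset_iff, ha, hb]) (by simp)
      have h1 := hφ a b hab hpair
      rw [key _ hpair F hF a (by simp) b (by simp) ha hb] at h1
      revert h1
      generalize σ F a = i
      generalize σ F b = j
      generalize φ a = k
      generalize φ b = l
      revert i j k l; decide
    choose κ hκ' using fun F : Finset V => show ∃ k, F ∈ Γ.faces → ∀ a ∈ F, k + σ F a = φ a by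
      by_cases hF : F ∈ Γ.faces
      · obtain ⟨a, ha⟩ := nonempty_of_mem_faces hF
        refine ⟨σ F a + φ a, fun _ b hb => ?_⟩
        rw [hκ F hF a ha b hb]
        generalize σ F b = i
        generalize φ b = j
        revert i j; decide
      · exact ⟨0, fun h => (hF h).elim⟩
    let M : Finset V → (V → ℝ) → Sphere2 := fun F x => flip (κ F) (L F x)
    have hM : ∀ F ∈ Γ.faces, ContinuousOn (M F) (closedFace F) := fun F hF =>
      (continuous_flip _).comp_continuousOn (hL F hF).1
    have hMh : ∀ F ∈ Γ.faces, ∀ x ∈ closedFace F, proj (M F x) = h x := fun F hF x hx => by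
      rw [← (hL F hF).2 x hx]; exact proj_flip _ _
    have hMv : ∀ F ∈ Γ.faces, ∀ a ∈ F, M F (Pi.single a 1) = flip (φ a) (s a) :=
      fun F hF a ha => by
        show flip (κ F) (L F (Pi.single a 1)) = _
        rw [hσ F a hF ha, flip_flip, hκ' F hF a ha]
    have hMM : ∀ F ∈ Γ.faces, ∀ x ∈ closedFace F, M (carrier x) x = M F x := by
      intro F hF x hx
      have hc : carrier x ⊆ F := (carrier_subset_iff hx.1).2 hx
      have hcf := carrier_mem_faces (hsub F hF hx)
      obtain ⟨a, ha⟩ := carrier_nonempty hx.1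
      refine eqOn_of_lift (hM _ hcf) ((hM F hF).mono (closedFace_mono hc)) (fun y hy => ?_) ha ?_
        ((carrier_subset_iff hx.1).1 subset_rfl)
      · rw [hMh _ hcf y hy, hMh F hF y (closedFace_mono hc hy)]
      · rw [hMv _ hcf a ha, hMv F hF a (hc ha)]
    have hcont : Continuous fun x : Realization Γ => M (carrier (x : V → ℝ)) x := by
      refine LocallyFinite.continuous
        (f := fun F : Γ.faces => (Subtype.val ⁻¹' closedFace F.1 : Set (Realization Γ)))
        (locallyFinite_of_finite _) ?_ (fun F => (isClosed_closedFace _).preimage continuous_subtype_val) ?_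
      · refine eq_univ_of_forall fun x => mem_iUnion.2 ?_
        obtain ⟨F, hF, hx⟩ := mem_realizationSet.1 x.2
        exact ⟨⟨F, hF⟩, hx⟩
      · rintro ⟨F, hF⟩
        refine ((hM F hF).comp continuous_subtype_val.continuousOn fun x hx => hx).congr ?_
        intro x hx
        exact hMM F hF x hx
    refine not_exists_section (fun p => M (carrier (e.symm p : V → ℝ)) (e.symm p))
      (hcont.comp e.symm.continuous) fun p => ?_
    obtain ⟨F, hF, hx⟩ := mem_realizationSet.1 (e.symm p).2
    rw [hMM F hF _ hx, hMh F hF _ hx]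
    simp [h]

end Cocycle

/-! ### Face counting and the Euler inequality. -/

section Counting

variable {V : Type*} [Fintype V] [DecidableEq V] {Γ : PreAbstractSimplicialComplex V}

open Classical in
/-- The faces with `k` vertices. -/
noncomputable def facesOfCard (Γ : PreAbstractSimplicialComplex V) (k : ℕ) : Finset (Finset V) :=
  {s | s ∈ Γ.faces ∧ s.card = k}

theorem mem_facesOfCard {k : ℕ} {s : Finset V} :
    s ∈ facesOfCard Γ k ↔ s ∈ Γ.faces ∧ s.card = k := by
  classical simp [facesOfCard]

theorem faceNumber_eq_card (Γ : PreAbstractSimplicialComplex V) (k : ℕ) :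
    faceNumber Γ k = (facesOfCard Γ (k + 1)).card := by
  rw [faceNumber, ← Set.ncard_coe_finset]
  congr 1
  ext s
  simp only [mem_ofPred_eq, Finset.mem_coe, mem_facesOfCard, IsFace]
  constructor
  · rintro ⟨rfl | h, hc⟩
    · simp at hc; omega
    · exact ⟨h, by exact_mod_cast hc⟩
  · rintro ⟨h, hc⟩
    exact ⟨Or.inr h, by exact_mod_cast hc⟩

/-- The triangles containing an edge are two in number. -/
theorem card_triangles_over_edge (hΓ : Triangulates Γ RealProjectivePlane) {e : Finset V}
    (he : e ∈ facesOfCard Γ 2) : {t ∈ facesOfCard Γ 3 | e ⊆ t}.card = 2 := by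
  rw [mem_facesOfCard] at he
  obtain ⟨a, b, hab, rfl⟩ := Finset.card_eq_two.1 he.2
  obtain ⟨c, d, hcd, hca, hcb, hda, hdb, hc, hd, hall⟩ := exists_two_triangles hΓ hab he.1
  have : {t ∈ facesOfCard Γ 3 | {a, b} ⊆ t} = {{a, b, c}, {a, b, d}} := by
    ext t
    simp only [Finset.mem_filter, mem_facesOfCard, Finset.mem_insert, Finset.mem_singleton]
    constructor
    · rintro ⟨⟨ht, htc⟩, hsub⟩
      obtain ⟨e, he⟩ := Finset.card_eq_one.1 (show (t \ {a, b}).card = 1 by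
        rw [Finset.card_sdiff_of_subset hsub, htc, Finset.card_pair hab])
      have hem : e ∈ t \ {a, b} := by rw [he]; simp
      have hte : t = {a, b, e} := by
        rw [← Finset.union_sdiff_of_subset hsub, he]
        ext v; simp
      simp only [Finset.mem_sdiff, Finset.mem_insert, Finset.mem_singleton, not_or] at hem
      subst hte
      rcases hall e hem.2.1 hem.2.2 ht with rfl | rfl <;> simp
    · rintro (rfl | rfl)
      · exact ⟨⟨hc, Finset.card_eq_three.2 ⟨a, b, c, hab, hca.symm, hcb.symm, rfl⟩⟩,
          by simp [Finset.insert_subset_iff]⟩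
      · exact ⟨⟨hd, Finset.card_eq_three.2 ⟨a, b, d, hab, hda.symm, hdb.symm, rfl⟩⟩,
          by simp [Finset.insert_subset_iff]⟩
  rw [this, Finset.card_pair]
  intro h
  have : c ∈ ({a, b, d} : Finset V) := h ▸ (by simp)
  simp [hca, hcb, hcd] at this

/-- Incident pairs of an edge and a triangle are counted in two ways. -/
theorem three_mul_triangles (hΓ : Triangulates Γ RealProjectivePlane) :
    (facesOfCard Γ 2).card * 2 = (facesOfCard Γ 3).card * 3 := by
  refine Finset.card_mul_eq_card_mul (fun (e t : Finset V) => e ⊆ t)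
    (fun e he => card_triangles_over_edge hΓ he) fun t ht => ?_
  · rw [mem_facesOfCard] at ht
    have : Finset.bipartiteBelow (fun e t => e ⊆ t) (facesOfCard Γ 2) t = t.powersetCard 2 := by
      ext e
      simp only [Finset.mem_bipartiteBelow, mem_facesOfCard, Finset.mem_powersetCard]
      constructor
      · rintro ⟨⟨-, hc⟩, hsub⟩; exact ⟨hsub, hc⟩
      · rintro ⟨hsub, hc⟩
        exact ⟨⟨mem_faces_of_subset ht.1 hsub (Finset.card_pos.1 (by omega)), hc⟩, hsub⟩
    rw [this, Finset.card_powersetCard, ht.2]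
    rfl

/-- The incidence matrix between faces with `k + 1` and with `k` vertices. -/
def incidence (Γ : PreAbstractSimplicialComplex V) (k : ℕ) :
    Matrix (facesOfCard Γ (k + 1)) (facesOfCard Γ k) (ZMod 2) :=
  Matrix.of fun t s => if s.1 ⊆ t.1 then 1 else 0

theorem incidence_mulVec {k : ℕ} (hk : k ≠ 0) (φ : Finset V → ZMod 2)
    (t : facesOfCard Γ (k + 1)) : (incidence Γ k).mulVec (fun s => φ s) t =
      ∑ s ∈ t.1.powersetCard k, φ s := by
  have ht := mem_facesOfCard.1 t.2
  have : t.1.powersetCard k = {s ∈ facesOfCard Γ k | s ⊆ t.1} := by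
    ext s
    simp only [Finset.mem_powersetCard, Finset.mem_filter, mem_facesOfCard]
    constructor
    · rintro ⟨hs, hc⟩
      exact ⟨⟨mem_faces_of_subset ht.1 hs (Finset.card_pos.1 (by omega)), hc⟩, hs⟩
    · rintro ⟨⟨-, hc⟩, hs⟩
      exact ⟨hs, hc⟩
  rw [this, Finset.sum_filter, ← Finset.sum_coe_sort]
  simp [Matrix.mulVec, dotProduct, incidence]

/-- Extension by zero allows values to be written as `ψ {a, b}` without carrying membership proofs.
-/
theorem exists_extension {k : ℕ} (φ : facesOfCard Γ k → ZMod 2) :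
    ∃ ψ : Finset V → ZMod 2, φ = fun s => ψ s.1 := by
  classical
  exact ⟨fun s => if h : s ∈ facesOfCard Γ k then φ ⟨s, h⟩ else 0, by ext s; simp⟩

theorem powersetCard_one_pair (a b : V) :
    ({a, b} : Finset V).powersetCard 1 = {{a}, {b}} := by
  ext s
  simp only [Finset.mem_powersetCard, Finset.mem_insert, Finset.mem_singleton]
  constructor
  · rintro ⟨hs, hc⟩
    obtain ⟨v, rfl⟩ := Finset.card_eq_one.1 hc
    simpa using hs
  · rintro (rfl | rfl) <;> simp

theorem sum_powersetCard_two {M : Type*} [AddCommMonoid M] {a b c : V} (hab : a ≠ b) (hac : a ≠ c)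
    (hbc : b ≠ c) (f : Finset V → M) :
    ∑ s ∈ ({a, b, c} : Finset V).powersetCard 2, f s = f {a, b} + (f {a, c} + f {b, c}) := by
  have h1 : ({a, b} : Finset V) ≠ {a, c} := fun h => by
    have : b ∈ ({a, c} : Finset V) := h ▸ (by simp)
    simp [hab.symm, hbc] at this
  have h2 : ({a, b} : Finset V) ≠ {b, c} := fun h => by
    have : a ∈ ({b, c} : Finset V) := h ▸ (by simp)
    simp [hab, hac] at this
  have h3 : ({a, c} : Finset V) ≠ {b, c} := fun h => by
    have : a ∈ ({b, c} : Finset V) := h ▸ (by simp)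
    simp [hab, hac] at this
  have : ({a, b, c} : Finset V).powersetCard 2 = {{a, b}, {a, c}, {b, c}} := by
    symm
    refine Finset.eq_of_subset_of_card_le ?_ ?_
    · intro s hs
      simp only [Finset.mem_insert, Finset.mem_singleton] at hs
      rw [Finset.mem_powersetCard]
      rcases hs with rfl | rfl | rfl
      · exact ⟨by simp [Finset.insert_subset_iff], Finset.card_pair hab⟩
      · exact ⟨by simp [Finset.insert_subset_iff], Finset.card_pair hac⟩
      · exact ⟨by simp, Finset.card_pair hbc⟩
    · rw [Finset.card_powersetCard, Finset.card_eq_three.2 ⟨a, b, c, hab, hac, hbc, rfl⟩]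
      exact (Finset.card_eq_three.2 ⟨_, _, _, h1, h2, h3, rfl⟩).ge
  rw [this, Finset.sum_insert (by simp [h1, h2]), Finset.sum_pair h3]

theorem exists_triangle (hΓ : Triangulates Γ RealProjectivePlane) : ∃ T ∈ Γ.faces, T.card = 3 := by
  obtain ⟨e⟩ := hΓ
  obtain ⟨s, hs, -⟩ := mem_realizationSet.1 (e.symm (proj (Classical.arbitrary _))).2
  obtain ⟨T, hT, -, hc⟩ := exists_triangle_supset ⟨e⟩ hs
  exact ⟨T, hT, hc⟩

theorem add_eq_zero_iff_eq_zmod_two {a b : ZMod 2} : a + b = 0 ↔ a = b := by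
  revert a b; decide

/-- A function on vertices with equal values at the ends of every edge is constant. -/
theorem eq_of_adjacent_eq (hΓ : Triangulates Γ RealProjectivePlane) {α : Type*} {φ : V → α}
    (h : ∀ a b, a ≠ b → {a, b} ∈ Γ.faces → φ a = φ b) {v w : V} (hv : {v} ∈ Γ.faces)
    (hw : {w} ∈ Γ.faces) : φ v = φ w := by
  have hface : ∀ F ∈ Γ.faces, ∀ a ∈ F, ∀ b ∈ F, φ a = φ b := fun F hF a ha b hb => by
    by_cases hab : a = b
    · rw [hab]
    · exact h a b hab (mem_faces_of_subset hF (by simp [Finset.insert_subset_iff, ha, hb]) (by simp))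
  obtain ⟨T, hT, hvT, hTc⟩ := exists_triangle_supset hΓ hv
  obtain ⟨T', hT', hwT, hTc'⟩ := exists_triangle_supset hΓ hw
  rw [Finset.singleton_subset_iff] at hvT hwT
  refine triangle_induction hΓ (p := fun S => ∀ w ∈ S, φ v = φ w) hT hTc
    (fun w hw => hface T hT v hvT w hw) ?_ hT' hTc' w hwT
  intro S _ S' hS' _ _ hSS' hp w hw
  obtain ⟨x, hx⟩ := Finset.card_pos.1 (show 0 < (S ∩ S').card by omega)
  rw [Finset.mem_inter] at hx
  rw [hp x hx.1, hface S' hS' x hx.2 w hw]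

/-- The kernel consists of the functions with equal values at the ends of every edge. These are
constant by connectedness, so evaluation at one vertex bounds the dimension of the kernel by one. -/
theorem rank_incidence_one (hΓ : Triangulates Γ RealProjectivePlane) :
    (facesOfCard Γ 1).card ≤ (incidence Γ 1).rank + 1 := by
  obtain ⟨T, hT, hTc⟩ := exists_triangle hΓ
  obtain ⟨v, hv⟩ := nonempty_of_mem_faces hT
  have hvΓ : {v} ∈ Γ.faces := mem_faces_of_subset hT (by simpa using hv) (by simp)
  let v' : facesOfCard Γ 1 := ⟨{v}, mem_facesOfCard.2 ⟨hvΓ, by simp⟩⟩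
  let ev : LinearMap.ker (incidence Γ 1).mulVecLin →ₗ[ZMod 2] ZMod 2 :=
    LinearMap.proj v' ∘ₗ Submodule.subtype _
  have hinj : Function.Injective ev := by
    rw [← LinearMap.ker_eq_bot, LinearMap.ker_eq_bot']
    rintro ⟨φ, hφ⟩ h0
    obtain ⟨ψ, rfl⟩ := exists_extension φ
    have hψ0 : ψ {v} = 0 := h0
    have hedge : ∀ a b, a ≠ b → {a, b} ∈ Γ.faces → ψ {a} = ψ {b} := by
      intro a b hab he
      have h1 := congrFun (LinearMap.mem_ker.1 hφ)
        ⟨{a, b}, mem_facesOfCard.2 ⟨he, Finset.card_pair hab⟩⟩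
      rw [Matrix.mulVecLin_apply, incidence_mulVec one_ne_zero, powersetCard_one_pair a b,
        Finset.sum_pair (by simpa using hab)] at h1
      exact add_eq_zero_iff_eq_zmod_two.1 h1
    ext s
    obtain ⟨hs, hsc⟩ := mem_facesOfCard.1 s.2
    obtain ⟨w, hw⟩ := Finset.card_eq_one.1 hsc
    have := eq_of_adjacent_eq hΓ (φ := fun v => ψ {v}) hedge hvΓ (hw ▸ hs)
    show ψ s.1 = 0
    rw [hw, ← hψ0]
    exact this.symm
  have h1 := LinearMap.finrank_le_finrank_of_injective hinj
  have h2 := LinearMap.finrank_range_add_finrank_ker (incidence Γ 1).mulVecLin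
  rw [Module.finrank_self] at h1
  rw [Module.finrank_fintype_fun_eq_card, Fintype.card_coe] at h2
  rw [Matrix.rank]
  omega

/-- The kernel of the transpose consists of the functions taking equal values on the two triangles
over each edge. They are constant by `triangle_induction`, so this kernel has dimension at most one.
-/
theorem rank_incidence_two (hΓ : Triangulates Γ RealProjectivePlane) :
    (facesOfCard Γ 3).card ≤ (incidence Γ 2).rank + 1 := by
  obtain ⟨T, hT, hTc⟩ := exists_triangle hΓ
  let T' : facesOfCard Γ 3 := ⟨T, mem_facesOfCard.2 ⟨hT, hTc⟩⟩
  let ev : LinearMap.ker (incidence Γ 2).transpose.mulVecLin →ₗ[ZMod 2] ZMod 2 :=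
    LinearMap.proj T' ∘ₗ Submodule.subtype _
  have hinj : Function.Injective ev := by
    rw [← LinearMap.ker_eq_bot, LinearMap.ker_eq_bot']
    rintro ⟨φ, hφ⟩ h0
    obtain ⟨ψ, rfl⟩ := exists_extension φ
    have hψ0 : ψ T = 0 := h0
    ext s
    obtain ⟨hs, hsc⟩ := mem_facesOfCard.1 s.2
    refine triangle_induction hΓ (p := fun S => ψ S = 0) hT hTc hψ0 ?_ hs hsc
    intro S hS S' hS' hSc hSc' hSS' hp
    by_cases hne : S = S'
    · rwa [← hne]
    have hcard : (S ∩ S').card = 2 := by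
      refine le_antisymm ?_ hSS'
      by_contra hlt
      have h1 : S ∩ S' = S := Finset.eq_of_subset_of_card_le Finset.inter_subset_left (by omega)
      have h2 : S ∩ S' = S' := Finset.eq_of_subset_of_card_le Finset.inter_subset_right (by omega)
      exact hne (h1.symm.trans h2)
    have hmemI : S ∩ S' ∈ facesOfCard Γ 2 := mem_facesOfCard.2 ⟨mem_faces_of_subset hS
      Finset.inter_subset_left (Finset.card_pos.1 (by omega)), hcard⟩
    have h1 := congrFun (LinearMap.mem_ker.1 hφ) ⟨S ∩ S', hmemI⟩
    have hfilter : {t ∈ facesOfCard Γ 3 | S ∩ S' ⊆ t} = {S, S'} := by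
      symm
      refine Finset.eq_of_subset_of_card_le ?_ ?_
      · simp [Finset.insert_subset_iff, mem_facesOfCard, *]
      · rw [Finset.card_pair hne, card_triangles_over_edge hΓ hmemI]
    have h3 : (incidence Γ 2).transpose.mulVec (fun s => ψ s.1) ⟨S ∩ S', hmemI⟩ =
        ∑ t ∈ facesOfCard Γ 3 with S ∩ S' ⊆ t, ψ t := by
      rw [Finset.sum_filter, ← Finset.sum_coe_sort]
      simp [Matrix.mulVec, dotProduct, incidence]
    rw [Matrix.mulVecLin_apply, h3, hfilter, Finset.sum_pair hne] at h1
    have h4 := add_eq_zero_iff_eq_zmod_two.1 h1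
    rw [← h4, hp]
  have h1 := LinearMap.finrank_le_finrank_of_injective hinj
  have h2 := LinearMap.finrank_range_add_finrank_ker (incidence Γ 2).transpose.mulVecLin
  rw [Module.finrank_self] at h1
  rw [Module.finrank_fintype_fun_eq_card, Fintype.card_coe] at h2
  change _ + _ = (facesOfCard Γ 3).card at h2
  rw [← Matrix.rank_transpose, Matrix.rank]
  omega

theorem exists_pair_function (z : V → V → ZMod 2) (hz : ∀ a b, z a b = z b a) :
    ∃ ζ : Finset V → ZMod 2, ∀ a b, a ≠ b → ζ {a, b} = z a b := by
  classical
  have : ∀ s : Finset V, ∃ k, ∀ a b, a ≠ b → s = {a, b} → k = z a b := fun s => by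
    by_cases hs : s.card = 2
    · obtain ⟨a, b, -, rfl⟩ := Finset.card_eq_two.1 hs
      refine ⟨z a b, fun c d hcd h => ?_⟩
      have hc : c ∈ ({a, b} : Finset V) := h ▸ (by simp)
      have hd : d ∈ ({a, b} : Finset V) := h ▸ (by simp)
      simp only [Finset.mem_insert, Finset.mem_singleton] at hc hd
      rcases hc with rfl | rfl <;> rcases hd with rfl | rfl
      · exact (hcd rfl).elim
      · rfl
      · exact hz _ _
      · exact (hcd rfl).elim
    · exact ⟨0, fun a b hab h => (hs (h ▸ Finset.card_pair hab)).elim⟩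
  choose ζ hζ using this
  exact ⟨ζ, fun a b hab => hζ _ a b hab rfl⟩

/-- The Euler characteristic of a triangulated projective plane is at most one. -/
theorem euler_le (hΓ : Triangulates Γ RealProjectivePlane) :
    (facesOfCard Γ 1).card + (facesOfCard Γ 3).card ≤ (facesOfCard Γ 2).card + 1 := by
  obtain ⟨z, hz, hcoc, hnot⟩ := exists_cocycle hΓ
  obtain ⟨ζ, hζ⟩ := exists_pair_function z hz
  have htwo : ∀ x : ZMod 2, x + x = 0 := by decide
  have hker : (fun s => ζ s.1) ∈ LinearMap.ker (incidence Γ 2).mulVecLin := by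
    rw [LinearMap.mem_ker]
    ext ⟨t, ht⟩
    obtain ⟨htΓ, htc⟩ := mem_facesOfCard.1 ht
    obtain ⟨a, b, c, hab, hac, hbc, rfl⟩ := Finset.card_eq_three.1 htc
    rw [Matrix.mulVecLin_apply, incidence_mulVec two_ne_zero]
    show ∑ s ∈ ({a, b, c} : Finset V).powersetCard 2, ζ s = 0
    rw [sum_powersetCard_two hab hac hbc,
      hζ a b hab, hζ a c hac, hζ b c hbc, ← hcoc _ htΓ a (by simp) b (by simp) c (by simp)]
    generalize z a b = i
    generalize z b c = j
    revert i j; decide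
  have hrange : (fun s => ζ s.1) ∉ LinearMap.range (incidence Γ 1).mulVecLin := by
    rintro ⟨φ, hφ⟩
    obtain ⟨ψ, rfl⟩ := exists_extension φ
    obtain ⟨a, b, hab, he, hne⟩ := hnot fun v => ψ {v}
    have h1 := congrFun hφ ⟨{a, b}, mem_facesOfCard.2 ⟨he, Finset.card_pair hab⟩⟩
    rw [Matrix.mulVecLin_apply, incidence_mulVec one_ne_zero, powersetCard_one_pair a b,
      Finset.sum_pair (by simpa using hab)] at h1
    exact hne ((hζ a b hab).symm.trans h1.symm)
  have hle : LinearMap.range (incidence Γ 1).mulVecLin ≤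
      LinearMap.ker (incidence Γ 2).mulVecLin := by
    rintro _ ⟨φ, rfl⟩
    obtain ⟨ψ, rfl⟩ := exists_extension φ
    have hval : (incidence Γ 1).mulVecLin (fun s => ψ s.1) =
        fun s => ∑ r ∈ s.1.powersetCard 1, ψ r := by
      ext s
      rw [Matrix.mulVecLin_apply, incidence_mulVec one_ne_zero]
    rw [hval, LinearMap.mem_ker]
    ext ⟨t, ht⟩
    obtain ⟨htΓ, htc⟩ := mem_facesOfCard.1 ht
    obtain ⟨a, b, c, hab, hac, hbc, rfl⟩ := Finset.card_eq_three.1 htc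
    rw [Matrix.mulVecLin_apply,
      incidence_mulVec two_ne_zero (fun s => ∑ r ∈ s.powersetCard 1, ψ r)]
    show ∑ s ∈ ({a, b, c} : Finset V).powersetCard 2, ∑ r ∈ s.powersetCard 1, ψ r = 0
    rw [sum_powersetCard_two hab hac hbc,
      powersetCard_one_pair a b, powersetCard_one_pair a c, powersetCard_one_pair b c,
      Finset.sum_pair (by simpa using hab), Finset.sum_pair (by simpa using hac),
      Finset.sum_pair (by simpa using hbc)]
    generalize ψ {a} = i
    generalize ψ {b} = j
    generalize ψ {c} = k
    revert i j k; decide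
  -- The cocycle makes the inclusion of coboundaries in cocycles strict, which lowers the bound on
  -- the sum of the two ranks to `f₁ - 1`.
  have hlt : Module.finrank (ZMod 2) (LinearMap.range (incidence Γ 1).mulVecLin) <
      Module.finrank (ZMod 2) (LinearMap.ker (incidence Γ 2).mulVecLin) := Submodule.finrank_lt_finrank_of_lt
    (lt_of_le_of_ne hle fun h => hrange (h ▸ hker))
  have h2 := LinearMap.finrank_range_add_finrank_ker (incidence Γ 2).mulVecLin
  rw [Module.finrank_fintype_fun_eq_card, Fintype.card_coe] at h2
  have h3 := rank_incidence_one hΓ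
  have h4 := rank_incidence_two hΓ
  rw [Matrix.rank] at h3 h4
  omega

end Counting

/-! ### Colour classes of a balanced triangulation. -/

section Colors

variable {V : Type*} [Fintype V] [DecidableEq V] {Γ : PreAbstractSimplicialComplex V}

/-- A balanced triangulation of the projective plane has a colouring with three colours. -/
theorem exists_coloring (hΓ : Triangulates Γ RealProjectivePlane) (hb : IsBalanced Γ) :
    ∃ κ : V → Fin 3, ∀ i j : V, i ≠ j → ({i, j} : Finset V) ∈ Γ.faces → κ i ≠ κ j := by
  obtain ⟨d, ⟨⟨s, hs, hsd⟩, hd⟩, κ, hκ⟩ := hb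
  obtain ⟨T, hT, hTc⟩ := exists_triangle hΓ
  have h1 := card_le_three hΓ hs
  have h2 := hd T hT
  obtain rfl : d = 2 := by omega
  exact ⟨κ, hκ⟩

/-- Each colour class of a balanced triangulation of the projective plane has at least three
vertices. -/
theorem three_le_card_colorClass (hΓ : Triangulates Γ RealProjectivePlane) {κ : V → Fin 3}
    (hκ : ∀ i j : V, i ≠ j → ({i, j} : Finset V) ∈ Γ.faces → κ i ≠ κ j) (k : Fin 3)
    {S : Finset V} (hS : ∀ v, {v} ∈ Γ.faces → κ v = k → v ∈ S) : 3 ≤ S.card := by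
  by_contra hlt
  have hpair : ∀ F ∈ Γ.faces, ∀ a ∈ F, ∀ b ∈ F, {a, b} ∈ Γ.faces := fun F hF a ha b hb =>
    mem_faces_of_subset hF (by simp [Finset.insert_subset_iff, ha, hb]) (by simp)
  have hinj : ∀ F ∈ Γ.faces, ∀ a ∈ F, ∀ b ∈ F, κ a = κ b → a = b := fun F hF a ha b hb h => by
    by_contra hab
    exact hκ a b hab (hpair F hF a ha b hb) h
  have hsing : ∀ F ∈ Γ.faces, ∀ a ∈ F, {a} ∈ Γ.faces := fun F hF a ha =>
    mem_faces_of_subset hF (by simpa using ha) (by simp)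
  have hmeet : ∀ T ∈ Γ.faces, T.card = 3 → ∃ v ∈ T, κ v = k := by
    intro T hT hTc
    have himg : T.image κ = Finset.univ := by
      refine Finset.eq_univ_of_card _ ?_
      rw [Finset.card_image_of_injOn fun a ha b hb h => hinj T hT a ha b hb h, hTc]
      rfl
    obtain ⟨v, hv, hvk⟩ := Finset.mem_image.1 (himg ▸ Finset.mem_univ k)
    exact ⟨v, hv, hvk⟩
  -- An edge avoiding the colour `k` lies in two triangles, and the third vertex of each must have
  -- colour `k`.
  have hopp : ∀ x y, x ≠ y → {x, y} ∈ Γ.faces → κ x ≠ k → κ y ≠ k → ∃ v w, v ≠ w ∧ κ v = k ∧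
      κ w = k ∧ {x, y, v} ∈ Γ.faces ∧ {x, y, w} ∈ Γ.faces := by
    intro x y hxy he hx hy
    obtain ⟨c, d, hcd, hcx, hcy, hdx, hdy, hc, hd, -⟩ := exists_two_triangles hΓ hxy he
    have hcol : ∀ c, c ≠ x → c ≠ y → {x, y, c} ∈ Γ.faces → κ c = k := by
      intro c hcx hcy hc
      obtain ⟨v, hv, hvk⟩ := hmeet _ hc
        (Finset.card_eq_three.2 ⟨x, y, c, hxy, hcx.symm, hcy.symm, rfl⟩)
      simp only [Finset.mem_insert, Finset.mem_singleton] at hv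
      rcases hv with rfl | rfl | rfl
      · exact (hx hvk).elim
      · exact (hy hvk).elim
      · exact hvk
    exact ⟨c, d, hcd, hcol c hcx hcy hc, hcol d hdx hdy hd, hc, hd⟩
  have hbase : ∀ T ∈ Γ.faces, 2 ≤ T.card → ∃ x ∈ T, κ x ≠ k := by
    intro T hT hTc
    obtain ⟨a, ha, b, hb, hab⟩ := Finset.one_lt_card.1 hTc
    by_cases h : κ a = k
    · exact ⟨b, hb, fun h' => hab (hinj T hT a ha b hb (h.trans h'.symm))⟩
    · exact ⟨a, ha, h⟩
  obtain ⟨T₀, hT₀, hT₀c⟩ := exists_triangle hΓ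
  obtain ⟨u, hu, huk⟩ := hmeet T₀ hT₀ hT₀c
  obtain ⟨x₀, hx₀, y₀, hy₀, hxy₀⟩ := Finset.one_lt_card.1
    (show 1 < (T₀.erase u).card by rw [Finset.card_erase_of_mem hu, hT₀c]; norm_num)
  rw [Finset.mem_erase] at hx₀ hy₀
  have hne : ∀ x ∈ T₀, x ≠ u → κ x ≠ k := fun x hx hxu h =>
    hxu (hinj T₀ hT₀ x hx u hu (h.trans huk.symm))
  obtain ⟨v, w, hvw, hv, hw, hvT, hwT⟩ := hopp x₀ y₀ hxy₀ (hpair T₀ hT₀ _ hx₀.2 _ hy₀.2)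
    (hne _ hx₀.2 hx₀.1) (hne _ hy₀.2 hy₀.1)
  have hclass : ∀ c, {c} ∈ Γ.faces → κ c = k → c = v ∨ c = w := by
    intro c hc hck
    by_contra! hno
    refine hlt ?_
    rw [← Finset.card_eq_three.2 ⟨c, v, w, hno.1, hno.2, hvw, rfl⟩]
    refine Finset.card_le_card ?_
    simp only [Finset.insert_subset_iff, Finset.singleton_subset_iff]
    exact ⟨hS c hc hck, hS v (hsing _ hvT v (by simp)) hv, hS w (hsing _ hwT w (by simp)) hw⟩
  -- With only `v` and `w` of colour `k`, every edge in the other colours is coned to both: the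
  -- complex is a suspension with apexes `v` and `w`.
  have hboth : ∀ x y, x ≠ y → {x, y} ∈ Γ.faces → κ x ≠ k → κ y ≠ k →
      {x, y, v} ∈ Γ.faces ∧ {x, y, w} ∈ Γ.faces := by
    intro x y hxy he hx hy
    obtain ⟨c, d, hcd, hc, hd, hcT, hdT⟩ := hopp x y hxy he hx hy
    rcases hclass c (hsing _ hcT c (by simp)) hc with rfl | rfl <;>
      rcases hclass d (hsing _ hdT d (by simp)) hd with rfl | rfl
    · exact (hcd rfl).elim
    · exact ⟨hcT, hdT⟩
    · exact ⟨hdT, hcT⟩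
    · exact (hcd rfl).elim
  obtain ⟨z, hz, hcoc, hnot⟩ := exists_cocycle hΓ
  have arith : ∀ p q r s m : ZMod 2, p + m = r → q + m = s → p + q = r + s := by decide
  have hlink : ∀ F ∈ Γ.faces, ∀ x ∈ F, ∀ y ∈ F, κ x ≠ k → κ y ≠ k →
      z v x + z w x = z v y + z w y := by
    intro F hF x hx y hy hxk hyk
    by_cases hxy : x = y
    · rw [hxy]
    obtain ⟨hv, hw⟩ := hboth x y hxy (hpair F hF x hx y hy) hxk hyk
    exact arith _ _ _ _ _ (hcoc _ hv v (by simp) x (by simp) y (by simp))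
      (hcoc _ hw w (by simp) x (by simp) y (by simp))
  -- The value of the cocycle along a path from `v` to `w` through `x` does not change along edges
  -- of the base, hence it is a constant `l`.
  set l := z v x₀ + z w x₀ with hl
  have hconst : ∀ T ∈ Γ.faces, T.card = 3 → ∀ x ∈ T, κ x ≠ k → z v x + z w x = l := by
    intro T hT hTc
    refine triangle_induction hΓ (p := fun T => ∀ x ∈ T, κ x ≠ k → z v x + z w x = l) hT₀ hT₀c
      (fun x hx hxk => hlink T₀ hT₀ x hx x₀ hx₀.2 hxk (hne _ hx₀.2 hx₀.1)) ?_ hT hTc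
    intro S hS S' hS' _ _ hSS' hp y hy hyk
    obtain ⟨x, hx, hxk⟩ := hbase (S ∩ S') (mem_faces_of_subset hS Finset.inter_subset_left
      (Finset.card_pos.1 (by omega))) hSS'
    rw [Finset.mem_inter] at hx
    rw [hlink S' hS' y hy x hx.2 hyk hxk, hp x hx.1 hxk]
  have hconst' : ∀ F ∈ Γ.faces, ∀ x ∈ F, κ x ≠ k → z v x + z w x = l := by
    intro F hF x hx hxk
    obtain ⟨T, hT, hFT, hTc⟩ := exists_triangle_supset hΓ hF
    exact hconst T hT hTc x (hFT hx) hxk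
  -- The potential integrates the cocycle from the apex `v`: zero at `v`, `l` at `w`, and `z v x` on
  -- the base. It bounds the cocycle, contradicting `hnot`.
  let φ : V → ZMod 2 := fun x => if κ x = k then (if x = v then 0 else l) else z v x
  have hcone : ∀ a b, {a, b} ∈ Γ.faces → κ a = k → κ b ≠ k → z a b = φ a + φ b := by
    intro a b hab ha hb
    have hlb := hconst' _ hab b (by simp) hb
    rcases hclass a (hsing _ hab a (by simp)) ha with rfl | rfl
    · simp [φ, ha, hb]
    · simp only [φ, ha, hb, hvw.symm, if_true, if_false, ← hlb]
      generalize z v b = i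
      generalize z a b = j
      revert i j; decide
  obtain ⟨a, b, hab, he, hne⟩ := hnot φ
  refine hne ?_
  by_cases ha : κ a = k
  · exact hcone a b he ha fun hb => hκ a b hab he (ha.trans hb.symm)
  by_cases hb : κ b = k
  · rw [hz, add_comm]
    exact hcone b a (by rwa [Finset.pair_comm]) hb ha
  · have := hcoc _ (hboth a b hab he ha hb).1 v (by simp) a (by simp) b (by simp)
    simp only [φ, ha, hb, if_false, ← this]
    generalize z v a = i
    generalize z a b = j
    revert i j; decide

theorem nine_le_card_vertices (hΓ : Triangulates Γ RealProjectivePlane) (hb : IsBalanced Γ) :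
    9 ≤ (facesOfCard Γ 1).card := by
  obtain ⟨κ, hκ⟩ := exists_coloring hΓ hb
  let S : Finset V := Finset.univ.filter fun v => {v} ∈ facesOfCard Γ 1
  have hcard : S.card ≤ (facesOfCard Γ 1).card :=
    Finset.card_le_card_of_injOn (fun v => {v}) (fun v hv => by simpa [S] using hv)
      Finset.singleton_injective.injOn
  refine le_trans ?_ hcard
  rw [Finset.card_eq_sum_card_fiberwise (f := κ) (t := Finset.univ) fun _ _ => Finset.mem_univ _]
  have : ∀ k ∈ (Finset.univ : Finset (Fin 3)), 3 ≤ (S.filter fun v => κ v = k).card := fun k _ =>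
    three_le_card_colorClass hΓ hκ k fun v hv hvk => by
      simp [S, mem_facesOfCard, hv, hvk]
  have h9 := Finset.card_nsmul_le_sum _ _ _ this
  simpa using h9

end Colors

/-! ### Finite verification for the nine-vertex complex. -/

section Delta

theorem mem_facesOfCard_deltaRP2 {k : ℕ} (hk : k ≠ 0) : facesOfCard deltaRP2 k =
    {s ∈ (Finset.univ : Finset (Fin 9)).powersetCard k | ∃ F ∈ facetsRP2, s ⊆ F} := by
  ext s
  simp only [mem_facesOfCard, Finset.mem_filter, Finset.mem_powersetCard_univ]
  constructor
  · rintro ⟨⟨-, h⟩, hc⟩; exact ⟨hc, h⟩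
  · rintro ⟨hc, h⟩
    exact ⟨⟨Finset.card_pos.1 (by omega), h⟩, hc⟩

theorem card_le_three_of_mem_deltaRP2 {s : Finset (Fin 9)} (hs : s ∈ deltaRP2.faces) :
    s.card ≤ 3 := by
  obtain ⟨-, F, hF, hsF⟩ := hs
  have : ∀ F ∈ facetsRP2, F.card = 3 := by decide +kernel
  exact (Finset.card_le_card hsF).trans (this F hF).le

theorem hasDim_deltaRP2 : HasDim deltaRP2 2 :=
  ⟨⟨{0, 3, 6}, ⟨by simp, {0, 3, 6}, by decide +kernel, subset_rfl⟩, by decide⟩,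
    fun _ hs => card_le_three_of_mem_deltaRP2 hs⟩

theorem isBalanced_deltaRP2 : IsBalanced deltaRP2 := by
  refine ⟨2, hasDim_deltaRP2, ![0, 0, 0, 1, 1, 1, 2, 2, 2], ?_⟩
  have h : ∀ F ∈ facetsRP2, ∀ i ∈ F, ∀ j ∈ F, i ≠ j →
      (![0, 0, 0, 1, 1, 1, 2, 2, 2] : Fin 9 → Fin 3) i ≠ ![0, 0, 0, 1, 1, 1, 2, 2, 2] j := by
    decide +kernel
  rintro i j hij ⟨-, F, hF, hsub⟩
  exact h F hF i (hsub (by simp)) j (hsub (by simp)) hij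

theorem faceNumber_neg_one {V : Type*} (K : PreAbstractSimplicialComplex V) :
    faceNumber K (-1) = 1 := by
  rw [faceNumber, Set.ncard_eq_one]
  refine ⟨∅, ?_⟩
  ext s
  constructor
  · rintro ⟨-, hc⟩
    exact Finset.card_eq_zero.1 (by simpa using hc)
  · rintro rfl
    exact ⟨Or.inl rfl, by simp⟩

theorem faceNumber_deltaRP2_zero : faceNumber deltaRP2 0 = 9 := by
  rw [show (0 : ℤ) = (0 : ℕ) from rfl, faceNumber_eq_card, mem_facesOfCard_deltaRP2 (by norm_num)]
  decide +kernel

theorem faceNumber_deltaRP2_one : faceNumber deltaRP2 1 = 24 := by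
  rw [show (1 : ℤ) = (1 : ℕ) from rfl, faceNumber_eq_card, mem_facesOfCard_deltaRP2 (by norm_num)]
  decide +kernel

theorem faceNumber_deltaRP2_two : faceNumber deltaRP2 2 = 16 := by
  rw [show (2 : ℤ) = (2 : ℕ) from rfl, faceNumber_eq_card, mem_facesOfCard_deltaRP2 (by norm_num)]
  decide +kernel

theorem faceNumber_deltaRP2_eq_zero {i : ℤ} (hi : i < -1 ∨ 2 < i) : faceNumber deltaRP2 i = 0 := by
  rw [faceNumber, Set.ncard_eq_zero]
  refine eq_empty_of_forall_notMem ?_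
  rintro s ⟨hs, hc⟩
  rcases hs with rfl | hs
  · simp at hc; omega
  · have := card_le_three_of_mem_deltaRP2 hs
    omega

end Delta

end BalancedRP2

open BalancedRP2 in
theorem mainTheorem2 :
    HasDim deltaRP2 2 ∧
    (faceNumber deltaRP2 (-1) = 1 ∧ faceNumber deltaRP2 0 = 9 ∧
      faceNumber deltaRP2 1 = 24 ∧ faceNumber deltaRP2 2 = 16) ∧
    IsBalanced deltaRP2 ∧
    Triangulates deltaRP2 RealProjectivePlane ∧
    ∀ (V : Type*) [Fintype V] [DecidableEq V] (Γ : PreAbstractSimplicialComplex V),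
      IsBalanced Γ → Triangulates Γ RealProjectivePlane →
        ∀ i : ℤ, faceNumber deltaRP2 i ≤ faceNumber Γ i := by
  refine ⟨hasDim_deltaRP2, ⟨faceNumber_neg_one _, faceNumber_deltaRP2_zero,
    faceNumber_deltaRP2_one, faceNumber_deltaRP2_two⟩, isBalanced_deltaRP2,
    triangulates_deltaRP2, ?_⟩
  intro V _ _ Γ hb hΓ i
  -- Substituting `f₂ = 2 f₁ / 3` and `f₀ ≥ 9` in `f₀ + f₂ ≤ f₁ + 1` gives `f₁ ≥ 24`, hence `f₂ ≥
  -- 16`.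
  have h0 := nine_le_card_vertices hΓ hb
  have h1 := three_mul_triangles hΓ
  have h2 := euler_le hΓ
  by_cases hi : i < -1 ∨ 2 < i
  · rw [faceNumber_deltaRP2_eq_zero hi]
    exact Nat.zero_le _
  obtain rfl | rfl | rfl | rfl : i = -1 ∨ i = 0 ∨ i = 1 ∨ i = 2 := by omega
  · rw [faceNumber_neg_one, faceNumber_neg_one]
  · rw [faceNumber_deltaRP2_zero]
    exact h0.trans_eq (faceNumber_eq_card Γ 0).symm
  · rw [faceNumber_deltaRP2_one]
    exact (show 24 ≤ (facesOfCard Γ 2).card by omega).trans_eq (faceNumber_eq_card Γ 1).symm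
  · rw [faceNumber_deltaRP2_two]
    exact (show 16 ≤ (facesOfCard Γ 3).card by omega).trans_eq (faceNumber_eq_card Γ 2).symm
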